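/- **Setting.** A *supergeometry* $(X,T^*_{X,-})$ is a complex manifold $X$ (compact or not) with a holomorphic vector bundle whose sheaf of holomorphic sections is $T^*_{X,-}$. Let $\mathcal Aut\,\wedge^\bullet T^*_{X,-}$ be the sheaf of groups of parity-preserving $\mathbb C$-algebra automorphisms of the sheaf $\wedge^\bullet T^*_{X,-}$. For $k\ge 2$ let $\mathcal G^{(k)}_X\subset\mathcal Aut\,\wedge^\bullet T^*_{X,-}$ be the subsheaf of those $\alpha$ with $\alpha(s)-s\in\bigoplus_{j\ge k}\wedge^jT^*_{X,-}$ for all local sections $s$. Then $\mathcal Q^{(k)}_X:=\mathcal G^{(k)}_X/\mathcal G^{(k+1)}_X$ is a sheaf of abelian groups. A *$(k-1)$-split supermanifold modelled on* $(X,T^*_{X,-})$ is an element $\mathfrak X$ of the Čech cohomology set $\check H^1(X,\mathcal G^{(k)}_X)$, and its *primary obstruction* $\omega(\mathfrak X)$ is its image in $H^1(X,\mathcal Q^{(k)}_X)$ under the map induced by $\mathcal G^{(k)}_X\to\mathcal Q^{(k)}_X$. An *embedding of supergeometries* $f=(i,f^\sharp):(Y,T^*_{Y,-})\subset(X,T^*_{X,-})$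 is a holomorphic embedding $i:Y\to X$ together with a surjective $\mathcal O_X$-linear morphism of sheaves $f^\sharp:T^*_{X,-}\to i_*T^*_{Y,-}$. Let $\mathcal G^{(k)}_{Y;X}\subset\mathcal G^{(k)}_X$ be the subsheaf of groups of those automorphisms that preserve the kernel of the induced morphism $\wedge^\bullet T^*_{X,-}\to i_*\wedge^\bullet T^*_{Y,-}$. It carries the inclusion $u:\mathcal G^{(k)}_{Y;X}\to\mathcal G^{(k)}_X$ and the restriction $r:\mathcal G^{(k)}_{Y;X}\to i_*\mathcal G^{(k)}_Y$, which sends an automorphism to the one it induces on $\wedge^\bullet T^*_{Y,-}$. A $(k-1)$-split supermanifold $\mathfrak Y\in\check H^1(Y,\mathcal G^{(k)}_Y)$ is a *submanifold of $\mathfrak X$ (over $f$)* if there is $\mathcal Z\in\check H^1(X,\mathcal G^{(k)}_{Y;X})$ with $r_*(\mathcal Z)=\mathfrak Y$ and $u_*(\mathcal Z)=\mathfrak X$. Put $\mathcal Q^{(k)}_{Y;X}:=\mathcal G^{(k)}_{Y;X}/\mathcal G^{(k+1)}_{Y;X}\subset\mathcal Q^{(k)}_X$ and $\mathcal R^{(k)}:=\mathcal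 Q^{(k)}_X/\mathcal Q^{(k)}_{Y;X}$, and let $\beta_{Y;X}:H^1(X,\mathcal Q^{(k)}_X)\to H^1(X,\mathcal R^{(k)})$ be the map induced by the projection. **Theorem.** Let $f:(Y,T^*_{Y,-})\subset(X,T^*_{X,-})$ be an embedding of supergeometries and let $k\ge 2$. If $\mathfrak X$ is a $(k-1)$-split supermanifold modelled on $(X,T^*_{X,-})$ with $\beta_{Y;X}(\omega(\mathfrak X))\neq 0$, then there is no $(k-1)$-split supermanifold $\mathfrak Y$ modelled on $(Y,T^*_{Y,-})$ that is a submanifold of $\mathfrak X$ over $f$. -/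

import Mathlib

open CategoryTheory Opposite TopologicalSpace
open scoped Manifold ContDiff Topology

universe u

/-- A supergeometry: a complex manifold `X` together with a holomorphic vector bundle `E` over it,
the odd conormal bundle.  Holomorphic means complex analytic.  Compactness is not required. -/
structure Supergeometry where
  /-- the model space of `X` -/
  Model : Type u
  [normModel : NormedAddCommGroup Model]
  [spaceModel : NormedSpace ℂ Model]
  [finModel : FiniteDimensional ℂ Model]
  /-- the complex manifold -/
  X : Type u
  [topX : TopologicalSpace X]
  [t2X : T2Space X]
  [secondX : SecondCountableTopology X]
  [chartedX : ChartedSpace Model X]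
  [manifoldX : IsManifold 𝓘(ℂ, Model) ω X]
  /-- the model fibre of the odd conormal bundle -/
  Fib : Type u
  [normFib : NormedAddCommGroup Fib]
  [spaceFib : NormedSpace ℂ Fib]
  [finFib : FiniteDimensional ℂ Fib]
  /-- the odd conormal bundle -/
  E : X → Type u
  [addE : ∀ x, AddCommGroup (E x)]
  [modE : ∀ x, Module ℂ (E x)]
  [topE : ∀ x, TopologicalSpace (E x)]
  [topTot : TopologicalSpace (Bundle.TotalSpace Fib E)]
  [fiberE : FiberBundle Fib E]
  [vectorE : VectorBundle ℂ Fib E]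
  [holoE : ContMDiffVectorBundle ω Fib E 𝓘(ℂ, Model)]

attribute [instance] Supergeometry.normModel Supergeometry.spaceModel Supergeometry.finModel
  Supergeometry.topX Supergeometry.t2X Supergeometry.secondX Supergeometry.chartedX
  Supergeometry.manifoldX Supergeometry.normFib Supergeometry.spaceFib Supergeometry.finFib
  Supergeometry.addE Supergeometry.modE Supergeometry.topE Supergeometry.topTot
  Supergeometry.fiberE Supergeometry.vectorE Supergeometry.holoE

section Fibre

variable (M : Type u) [AddCommGroup M] [Module ℂ M]

/-- `⊕_{j ≥ k} ⋀ʲ M` inside the exterior algebra of `M`. -/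
def extFilt (k : ℕ) : Submodule ℂ (ExteriorAlgebra ℂ M) := ⨆ (j : ℕ) (_ : k ≤ j), ⋀[ℂ]^j M

/-- `⊕_j ⋀²ʲ M`, the even part of the exterior algebra of `M`. -/
def extEven : Submodule ℂ (ExteriorAlgebra ℂ M) := ⨆ j : ℕ, ⋀[ℂ]^(2 * j) M

/-- `⊕_j ⋀²ʲ⁺¹ M`, the odd part of the exterior algebra of `M`. -/
def extOdd : Submodule ℂ (ExteriorAlgebra ℂ M) := ⨆ j : ℕ, ⋀[ℂ]^(2 * j + 1) M

variable {M}

theorem mem_extFilt {j k : ℕ} (h : k ≤ j) {a : ExteriorAlgebra ℂ M} (ha : a ∈ ⋀[ℂ]^j M) :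
    a ∈ extFilt M k :=
  le_iSup₂ (f := fun (j : ℕ) (_ : k ≤ j) => ⋀[ℂ]^j M) j h ha

theorem extFilt_anti {j k : ℕ} (h : k ≤ j) : extFilt M j ≤ extFilt M k :=
  iSup₂_le fun _ hi _ ha => mem_extFilt (h.trans hi) ha

theorem extFilt_zero (a : ExteriorAlgebra ℂ M) : a ∈ extFilt M 0 := by
  induction a using DirectSum.Decomposition.inductionOn (fun i : ℕ => ⋀[ℂ]^i M) with
  | zero => exact zero_mem _
  | homogeneous m => exact mem_extFilt (Nat.zero_le _) m.2
  | add _ _ h1 h2 => exact add_mem h1 h2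

theorem extFilt_mul {j k : ℕ} {a b : ExteriorAlgebra ℂ M} (ha : a ∈ extFilt M j)
    (hb : b ∈ extFilt M k) : a * b ∈ extFilt M (j + k) := by
  have key : extFilt M j * extFilt M k ≤ extFilt M (j + k) := by
    simp only [extFilt, Submodule.iSup_mul, Submodule.mul_iSup]
    refine iSup₂_le fun i hi => iSup₂_le fun i' hi' => ?_
    rw [Submodule.mul_le]
    intro m hm n hn
    exact mem_extFilt (by omega) (SetLike.mul_mem_graded (A := fun i : ℕ => ⋀[ℂ]^i M) hm hn)
  exact key (Submodule.mul_mem_mul ha hb)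

theorem extFilt_proj {j k : ℕ} (h : j < k) {a : ExteriorAlgebra ℂ M} (ha : a ∈ extFilt M k) :
    GradedRing.proj (fun i : ℕ => ⋀[ℂ]^i M) j a = 0 := by
  have : extFilt M k ≤ LinearMap.ker
      (GradedAlgebra.proj (fun i : ℕ => ⋀[ℂ]^i M) j) := by
    refine iSup₂_le fun i hi b hb => ?_
    rw [LinearMap.mem_ker, GradedAlgebra.proj_apply]
    exact DirectSum.decompose_of_mem_ne _ hb (by omega)
  exact this ha

theorem proj_same {j : ℕ} {a : ExteriorAlgebra ℂ M} (ha : a ∈ ⋀[ℂ]^j M) :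
    GradedRing.proj (fun i : ℕ => ⋀[ℂ]^i M) j a = a := by
  rw [GradedRing.proj_apply]
  exact DirectSum.decompose_of_mem_same _ ha

theorem proj_ne {i j : ℕ} (h : i ≠ j) {a : ExteriorAlgebra ℂ M} (ha : a ∈ ⋀[ℂ]^i M) :
    GradedRing.proj (fun i : ℕ => ⋀[ℂ]^i M) j a = 0 := by
  rw [GradedRing.proj_apply]
  exact DirectSum.decompose_of_mem_ne _ ha h

theorem extEven_proj {j : ℕ} (h : ¬ Even j) {a : ExteriorAlgebra ℂ M} (ha : a ∈ extEven M) :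
    GradedRing.proj (fun i : ℕ => ⋀[ℂ]^i M) j a = 0 := by
  have : extEven M ≤ LinearMap.ker
      (GradedAlgebra.proj (fun i : ℕ => ⋀[ℂ]^i M) j) := by
    refine iSup_le fun i b hb => ?_
    rw [LinearMap.mem_ker, GradedAlgebra.proj_apply]
    exact DirectSum.decompose_of_mem_ne _ hb (by rintro rfl; exact h (even_two_mul i))
  exact this ha

theorem extOdd_proj {j : ℕ} (h : Even j) {a : ExteriorAlgebra ℂ M} (ha : a ∈ extOdd M) :
    GradedRing.proj (fun i : ℕ => ⋀[ℂ]^i M) j a = 0 := by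
  have : extOdd M ≤ LinearMap.ker
      (GradedAlgebra.proj (fun i : ℕ => ⋀[ℂ]^i M) j) := by
    refine iSup_le fun i b hb => ?_
    rw [LinearMap.mem_ker, GradedAlgebra.proj_apply]
    exact DirectSum.decompose_of_mem_ne _ hb (by rintro rfl; exact (by grind))
  exact this ha

theorem eq_zero_of_proj {a : ExteriorAlgebra ℂ M}
    (h : ∀ j, GradedRing.proj (fun i : ℕ => ⋀[ℂ]^i M) j a = 0) : a = 0 := by
  classical
  rw [← DirectSum.sum_support_decompose (fun i : ℕ => ⋀[ℂ]^i M) a]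
  exact Finset.sum_eq_zero fun i _ => h i

theorem eq_zero_of_even_odd {a : ExteriorAlgebra ℂ M} (h0 : a ∈ extEven M) (h1 : a ∈ extOdd M) :
    a = 0 :=
  eq_zero_of_proj fun j => by
    by_cases hj : Even j
    · exact extOdd_proj hj h1
    · exact extEven_proj hj h0

theorem ext_map_mem {N : Type u} [AddCommGroup N] [Module ℂ N] (φ : M →ₗ[ℂ] N) {j : ℕ}
    {a : ExteriorAlgebra ℂ M} (ha : a ∈ ⋀[ℂ]^j M) : ExteriorAlgebra.map φ a ∈ ⋀[ℂ]^j N := by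
  have h : (⋀[ℂ]^j M).map (ExteriorAlgebra.map φ).toLinearMap ≤ ⋀[ℂ]^j N := by
    unfold ExteriorAlgebra.exteriorPower
    rw [Submodule.map_pow]
    refine pow_le_pow_left' ?_ j
    rintro _ ⟨_, ⟨m, rfl⟩, rfl⟩
    exact ⟨φ m, by simp⟩
  exact h ⟨a, ha, rfl⟩

theorem ext_map_filt {N : Type u} [AddCommGroup N] [Module ℂ N] (φ : M →ₗ[ℂ] N) {k : ℕ}
    {a : ExteriorAlgebra ℂ M} (ha : a ∈ extFilt M k) :
    ExteriorAlgebra.map φ a ∈ extFilt N k := by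
  have h : extFilt M k ≤ (extFilt N k).comap (ExteriorAlgebra.map φ).toLinearMap :=
    iSup₂_le fun i hi b hb => mem_extFilt hi (ext_map_mem φ hb)
  exact h ha

theorem ext_map_even {N : Type u} [AddCommGroup N] [Module ℂ N] (φ : M →ₗ[ℂ] N)
    {a : ExteriorAlgebra ℂ M} (ha : a ∈ extEven M) : ExteriorAlgebra.map φ a ∈ extEven N := by
  have h : extEven M ≤ (extEven N).comap (ExteriorAlgebra.map φ).toLinearMap :=
    iSup_le fun i b hb =>
      Submodule.mem_iSup_of_mem (p := fun j : ℕ => ⋀[ℂ]^(2 * j) N) i (ext_map_mem φ hb)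
  exact h ha

theorem ext_map_odd {N : Type u} [AddCommGroup N] [Module ℂ N] (φ : M →ₗ[ℂ] N)
    {a : ExteriorAlgebra ℂ M} (ha : a ∈ extOdd M) : ExteriorAlgebra.map φ a ∈ extOdd N := by
  have h : extOdd M ≤ (extOdd N).comap (ExteriorAlgebra.map φ).toLinearMap :=
    iSup_le fun i b hb =>
      Submodule.mem_iSup_of_mem (p := fun j : ℕ => ⋀[ℂ]^(2 * j + 1) N) i (ext_map_mem φ hb)
  exact h ha

end Fibre

namespace Supergeometry

variable (S : Supergeometry.{u})

/-- `g` is a holomorphic function on the open set `U` (its values outside `U` are irrelevant). -/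
def HolFun (U : Opens S.X) (g : S.X → ℂ) : Prop :=
  ContMDiffOn 𝓘(ℂ, S.Model) 𝓘(ℂ, ℂ) ω g U

/-- `σ` is a holomorphic section of the odd conormal bundle on the open set `U`
(its values outside `U` are irrelevant). -/
def HolSec (U : Opens S.X) (σ : ∀ x, S.E x) : Prop :=
  ContMDiffOn 𝓘(ℂ, S.Model) (𝓘(ℂ, S.Model).prod 𝓘(ℂ, S.Fib)) ω
    (fun x => Bundle.TotalSpace.mk' S.Fib x (σ x)) U

/-- The algebra of all (discontinuous) sections over `U` of the bundle of exterior algebras. -/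
abbrev RawSec (U : Opens S.X) : Type u := ∀ x : U, ExteriorAlgebra ℂ (S.E x)

/-- Restriction of discontinuous sections. -/
def rawRes {U V : Opens S.X} (h : V ≤ U) : S.RawSec U →ₐ[ℂ] S.RawSec V :=
  AlgHom.pi fun x : V =>
    Pi.evalAlgHom ℂ (fun x : U => ExteriorAlgebra ℂ (S.E x)) ⟨x.1, h x.2⟩

/-- Holomorphic functions on `U`, as sections of the bundle of exterior algebras. -/
def funSet (U : Opens S.X) : Set (S.RawSec U) :=
  {p | ∃ g, S.HolFun U g ∧ p = fun x : U => algebraMap ℂ _ (g x)}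

/-- Holomorphic sections of the odd conormal bundle on `U`, as sections of the bundle of exterior
algebras. -/
def secSet (U : Opens S.X) : Set (S.RawSec U) :=
  {p | ∃ σ, S.HolSec U σ ∧ p = fun x : U => ExteriorAlgebra.ι ℂ (σ x)}

/-- Finite sums of products of holomorphic functions and holomorphic sections of the odd conormal
bundle on `U`. -/
def polySec (U : Opens S.X) : Subalgebra ℂ (S.RawSec U) :=
  Algebra.adjoin ℂ (S.funSet U ∪ S.secSet U)

variable {S} in
theorem polySec_res {U V : Opens S.X} (h : V ≤ U) {p : S.RawSec U} (hp : p ∈ S.polySec U) :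
    S.rawRes h p ∈ S.polySec V := by
  have : (S.polySec U).map (S.rawRes h) ≤ S.polySec V := by
    rw [polySec, AlgHom.map_adjoin]
    refine Algebra.adjoin_mono ?_
    rintro _ ⟨p, ⟨g, hg, rfl⟩ | ⟨σ, hσ, rfl⟩, rfl⟩
    · exact Or.inl ⟨g, hg.mono h, rfl⟩
    · exact Or.inr ⟨σ, hσ.mono h, rfl⟩
  exact this ⟨p, hp, rfl⟩

/-- The sections over `U` of the sheaf `⋀^• E` of exterior algebras of the odd conormal bundle:
those sections of the bundle of exterior algebras which locally are finite sums of products of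
holomorphic functions and holomorphic sections of `E`. -/
def extSec (U : Opens S.X) : Subalgebra ℂ (S.RawSec U) where
  carrier := {p | ∀ x ∈ U, ∃ (V : Opens S.X) (h : V ≤ U), x ∈ V ∧ S.rawRes h p ∈ S.polySec V}
  mul_mem' := by
    intro p q hp hq x hx
    obtain ⟨V, hV, hxV, hp⟩ := hp x hx
    obtain ⟨W, hW, hxW, hq⟩ := hq x hx
    refine ⟨V ⊓ W, inf_le_left.trans hV, ⟨hxV, hxW⟩, ?_⟩
    exact mul_mem (polySec_res inf_le_left hp) (polySec_res inf_le_right hq)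
  add_mem' := by
    intro p q hp hq x hx
    obtain ⟨V, hV, hxV, hp⟩ := hp x hx
    obtain ⟨W, hW, hxW, hq⟩ := hq x hx
    refine ⟨V ⊓ W, inf_le_left.trans hV, ⟨hxV, hxW⟩, ?_⟩
    exact add_mem (polySec_res inf_le_left hp) (polySec_res inf_le_right hq)
  algebraMap_mem' := by
    intro c x hx
    exact ⟨U, le_rfl, hx, (S.polySec U).algebraMap_mem c⟩

theorem polySec_le (U : Opens S.X) : S.polySec U ≤ S.extSec U :=
  fun _ hp _ hx => ⟨U, le_rfl, hx, hp⟩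

variable {S}

theorem extSec_res {U V : Opens S.X} (h : V ≤ U) {p : S.RawSec U} (hp : p ∈ S.extSec U) :
    S.rawRes h p ∈ S.extSec V := by
  intro x hx
  obtain ⟨W, hW, hxW, hp⟩ := hp x (h hx)
  exact ⟨W ⊓ V, inf_le_right, ⟨hxW, hx⟩, polySec_res inf_le_left hp⟩

/-- The restriction maps of the sheaf `⋀^• E`. -/
def res {U V : Opens S.X} (h : V ≤ U) : S.extSec U →ₐ[ℂ] S.extSec V :=
  ((S.rawRes h).comp (S.extSec U).val).codRestrict (S.extSec V) fun s => extSec_res h s.2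

@[simp]
theorem res_coe {U V : Opens S.X} (h : V ≤ U) (s : S.extSec U) (x : V) :
    (res h s).1 x = s.1 ⟨x.1, h x.2⟩ := rfl

/-- The sections of `⋀^• E` lying in `⊕_{j ≥ k} ⋀ʲ E`. -/
def InFilt (k : ℕ) {U : Opens S.X} (s : S.extSec U) : Prop := ∀ x, s.1 x ∈ extFilt (S.E x.1) k

/-- The even sections of `⋀^• E`. -/
def IsEven {U : Opens S.X} (s : S.extSec U) : Prop := ∀ x, s.1 x ∈ extEven (S.E x.1)

/-- The odd sections of `⋀^• E`. -/
def IsOdd {U : Opens S.X} (s : S.extSec U) : Prop := ∀ x, s.1 x ∈ extOdd (S.E x.1)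

variable (S) in
/-- A section over `U` of the sheaf of automorphisms of the sheaf of supercommutative
`ℂ`-algebras `⋀^• E`: a parity preserving automorphism of the restriction of `⋀^• E` to `U`. -/
@[ext]
structure SuperAut (U : Opens S.X) where
  /-- the automorphism on sections over `V ⊆ U` -/
  app : ∀ V : Opens S.X, V ≤ U → (S.extSec V ≃ₐ[ℂ] S.extSec V)
  res_app : ∀ (V W : Opens S.X) (hV : V ≤ U) (h : W ≤ V) (s : S.extSec V),
    res h (app V hV s) = app W (h.trans hV) (res h s)
  even_iff : ∀ (V : Opens S.X) (hV : V ≤ U) (s : S.extSec V), IsEven (app V hV s) ↔ IsEven s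
  odd_iff : ∀ (V : Opens S.X) (hV : V ≤ U) (s : S.extSec V), IsOdd (app V hV s) ↔ IsOdd s

namespace SuperAut

variable {U : Opens S.X}

instance : One (SuperAut S U) where
  one :=
    { app := fun _ _ => 1
      res_app := fun _ _ _ _ _ => rfl
      even_iff := fun _ _ _ => Iff.rfl
      odd_iff := fun _ _ _ => Iff.rfl }

/-- The product is composition. -/
instance : Mul (SuperAut S U) where
  mul α β :=
    { app := fun V hV => α.app V hV * β.app V hV
      res_app := fun V W hV h s => by
        rw [AlgEquiv.mul_apply, AlgEquiv.mul_apply, α.res_app, β.res_app]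
      even_iff := fun V hV s => (α.even_iff V hV _).trans (β.even_iff V hV s)
      odd_iff := fun V hV s => (α.odd_iff V hV _).trans (β.odd_iff V hV s) }

instance : Inv (SuperAut S U) where
  inv α :=
    { app := fun V hV => (α.app V hV)⁻¹
      res_app := fun V W hV h s => by
        apply (α.app W (h.trans hV)).injective
        rw [← α.res_app V W hV h]
        change res h (α.app V hV ((α.app V hV).symm s)) =
          α.app W _ ((α.app W _).symm (res h s))
        rw [AlgEquiv.apply_symm_apply, AlgEquiv.apply_symm_apply]
      even_iff := fun V hV s => by
        rw [← α.even_iff V hV]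
        change IsEven (α.app V hV ((α.app V hV).symm s)) ↔ _
        rw [AlgEquiv.apply_symm_apply]
      odd_iff := fun V hV s => by
        rw [← α.odd_iff V hV]
        change IsOdd (α.app V hV ((α.app V hV).symm s)) ↔ _
        rw [AlgEquiv.apply_symm_apply] }

theorem mul_app (α β : SuperAut S U) (V : Opens S.X) (hV : V ≤ U) :
    (α * β).app V hV = α.app V hV * β.app V hV := rfl

theorem inv_app (α : SuperAut S U) (V : Opens S.X) (hV : V ≤ U) :
    (α⁻¹).app V hV = (α.app V hV)⁻¹ := rfl

theorem one_app (V : Opens S.X) (hV : V ≤ U) : (1 : SuperAut S U).app V hV = 1 := rfl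

instance : Group (SuperAut S U) where
  mul_assoc α β γ := by
    ext1; funext V hV; simp only [mul_app, mul_assoc]
  one_mul α := by
    ext1; funext V hV; simp only [mul_app, one_app, one_mul]
  mul_one α := by
    ext1; funext V hV; simp only [mul_app, one_app, mul_one]
  inv_mul_cancel α := by
    ext1; funext V hV; simp only [mul_app, one_app, inv_app, inv_mul_cancel]

@[simp]
theorem mul_app_apply (α β : SuperAut S U) (V : Opens S.X) (hV : V ≤ U) (s : S.extSec V) :
    (α * β).app V hV s = α.app V hV (β.app V hV s) := rfl

@[simp]
theorem one_app_apply (V : Opens S.X) (hV : V ≤ U) (s : S.extSec V) :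
    (1 : SuperAut S U).app V hV s = s := rfl

@[simp]
theorem app_inv_app (α : SuperAut S U) (V : Opens S.X) (hV : V ≤ U) (s : S.extSec V) :
    α.app V hV ((α⁻¹).app V hV s) = s := (α.app V hV).apply_symm_apply s

@[simp]
theorem inv_app_app (α : SuperAut S U) (V : Opens S.X) (hV : V ≤ U) (s : S.extSec V) :
    (α⁻¹).app V hV (α.app V hV s) = s := (α.app V hV).symm_apply_apply s

/-- Restriction of automorphisms to a smaller open set. -/
def restr {V : Opens S.X} (h : V ≤ U) : SuperAut S U →* SuperAut S V where
  toFun α :=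
    { app := fun W hW => α.app W (hW.trans h)
      res_app := fun W W' hW h' s => α.res_app W W' (hW.trans h) h' s
      even_iff := fun W hW s => α.even_iff W (hW.trans h) s
      odd_iff := fun W hW s => α.odd_iff W (hW.trans h) s }
  map_one' := rfl
  map_mul' _ _ := rfl

end SuperAut

variable (S)

/-- The sheaf of groups of automorphisms of `⋀^• E`. -/
def autPresheaf : (Opens S.X)ᵒᵖ ⥤ GrpCat.{u} where
  obj U := GrpCat.of (SuperAut S U.unop)
  map f := GrpCat.ofHom (SuperAut.restr (leOfHom f.unop))

/-- The sections over `U` of Green's sheaf of groups `𝒢⁽ᵏ⁾`: the automorphisms `α` of `⋀^• E` with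
`α(s) - s ∈ ⊕_{j ≥ k} ⋀ʲ E` for all sections `s`. -/
def greenSub (k : ℕ) (U : Opens S.X) : Subgroup (SuperAut S U) where
  carrier := {α | ∀ (V : Opens S.X) (hV : V ≤ U) (s : S.extSec V), InFilt k (α.app V hV s - s)}
  one_mem' V hV s x := by simp
  mul_mem' := by
    intro α β hα hβ V hV s x
    have := add_mem (hα V hV (β.app V hV s) x) (hβ V hV s x)
    simpa using this
  inv_mem' := by
    intro α hα V hV s x
    have := neg_mem (hα V hV ((α⁻¹).app V hV s) x)
    simpa using this

theorem greenSub_anti {j k : ℕ} (h : j ≤ k) (U : Opens S.X) : S.greenSub k U ≤ S.greenSub j U :=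
  fun _ hα V hV s x => extFilt_anti h (hα V hV s x)

/-! ### Commutators in Green's groups -/

/-- Sums of products of a holomorphic function and `j` holomorphic sections of `E`. -/
def homSec (U : Opens S.X) : ℕ → Submodule ℂ (S.RawSec U)
  | 0 => Submodule.span ℂ (S.funSet U)
  | j + 1 => Submodule.span ℂ (S.secSet U) * homSec U j

variable {S}

theorem fun_mul_fun (U : Opens S.X) :
    Submodule.span ℂ (S.funSet U) * Submodule.span ℂ (S.funSet U) ≤
      Submodule.span ℂ (S.funSet U) := by
  rw [Submodule.span_mul_span]
  refine Submodule.span_mono ?_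
  rintro _ ⟨_, ⟨g, hg, rfl⟩, _, ⟨h, hh, rfl⟩, rfl⟩
  refine ⟨g * h, ContMDiffOn.mul hg hh, ?_⟩
  funext x
  simp

theorem fun_mul_sec (U : Opens S.X) :
    Submodule.span ℂ (S.funSet U) * Submodule.span ℂ (S.secSet U) ≤
      Submodule.span ℂ (S.secSet U) := by
  rw [Submodule.span_mul_span]
  refine Submodule.span_mono ?_
  rintro _ ⟨_, ⟨g, hg, rfl⟩, _, ⟨σ, hσ, rfl⟩, rfl⟩
  refine ⟨g • σ, ContMDiffOn.smul_section hg hσ, ?_⟩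
  funext x
  simp [Algebra.smul_def]

theorem fun_mul_hom (U : Opens S.X) (j : ℕ) :
    Submodule.span ℂ (S.funSet U) * S.homSec U j ≤ S.homSec U j := by
  cases j with
  | zero => exact fun_mul_fun U
  | succ j =>
    rw [homSec, ← mul_assoc]
    exact mul_le_mul_left (fun_mul_sec U) _

theorem hom_mul_hom (U : Opens S.X) (i j : ℕ) :
    S.homSec U i * S.homSec U j ≤ S.homSec U (i + j) := by
  induction i with
  | zero => rw [zero_add]; exact fun_mul_hom U j
  | succ i ih =>
    rw [Nat.add_right_comm, homSec, homSec, mul_assoc]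
    exact mul_le_mul_right ih _

theorem const_mem (U : Opens S.X) (c : ℂ) : algebraMap ℂ (S.RawSec U) c ∈ S.homSec U 0 :=
  Submodule.subset_span ⟨fun _ => c, contMDiffOn_const, rfl⟩

theorem polySec_le_hom (U : Opens S.X) {p : S.RawSec U} (hp : p ∈ S.polySec U) :
    p ∈ ⨆ j, S.homSec U j := by
  induction hp using Algebra.adjoin_induction with
  | mem p hp =>
    rcases hp with hp | hp
    · exact Submodule.mem_iSup_of_mem 0 (Submodule.subset_span hp)
    · refine Submodule.mem_iSup_of_mem 1 ?_
      have := Submodule.mul_mem_mul (Submodule.subset_span (R := ℂ) hp) (const_mem U 1)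
      rwa [map_one, mul_one] at this
  | algebraMap c => exact Submodule.mem_iSup_of_mem 0 (const_mem U c)
  | add _ _ _ _ h1 h2 => exact add_mem h1 h2
  | mul _ _ _ _ h1 h2 =>
    have := Submodule.mul_mem_mul h1 h2
    rw [Submodule.iSup_mul] at this
    simp only [Submodule.mul_iSup] at this
    refine (iSup_le fun i => iSup_le fun j => ?_ : _ ≤ ⨆ j, S.homSec U j) this
    exact (hom_mul_hom U i j).trans (le_iSup (S.homSec U) (i + j))

theorem homSec_le (U : Opens S.X) (j : ℕ) {p : S.RawSec U} (hp : p ∈ S.homSec U j) :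
    p ∈ S.polySec U := by
  have hT : Submodule.span ℂ (S.secSet U) ≤ Subalgebra.toSubmodule (S.polySec U) :=
    Submodule.span_le.2 fun _ hp => Algebra.subset_adjoin (Or.inr hp)
  have key : S.homSec U j ≤ Subalgebra.toSubmodule (S.polySec U) := by
    clear hp p
    induction j with
    | zero => exact Submodule.span_le.2 fun _ hp => Algebra.subset_adjoin (Or.inl hp)
    | succ j ih =>
      rw [homSec, Submodule.mul_le]
      exact fun m hm n hn => (S.polySec U).mul_mem (hT hm) (ih hn)
  exact key hp

theorem homSec_deg (U : Opens S.X) (j : ℕ) {p : S.RawSec U} (hp : p ∈ S.homSec U j) (x : U) :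
    p x ∈ ⋀[ℂ]^j (S.E x.1) := by
  induction j generalizing p with
  | zero =>
    refine Submodule.span_induction (p := fun p _ => p x ∈ ⋀[ℂ]^0 (S.E x.1)) ?_ ?_ ?_ ?_ hp
    · rintro _ ⟨g, hg, rfl⟩
      exact SetLike.algebraMap_mem_graded (fun i : ℕ => ⋀[ℂ]^i (S.E x.1)) _
    · exact zero_mem _
    · exact fun _ _ _ _ h1 h2 => add_mem h1 h2
    · exact fun c _ _ h => Submodule.smul_mem _ c h
  | succ j ih =>
    refine Submodule.mul_induction_on (C := fun p => p x ∈ ⋀[ℂ]^(j + 1) (S.E x.1)) hp ?_ ?_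
    · intro m hm n hn
      have hm' : m x ∈ ⋀[ℂ]^1 (S.E x.1) := by
        refine Submodule.span_induction (p := fun p _ => p x ∈ ⋀[ℂ]^1 (S.E x.1)) ?_ ?_ ?_ ?_ hm
        · rintro _ ⟨σ, hσ, rfl⟩
          simp [ExteriorAlgebra.exteriorPower]
        · exact zero_mem _
        · exact fun _ _ _ _ h1 h2 => add_mem h1 h2
        · exact fun c _ _ h => Submodule.smul_mem _ c h
      have := SetLike.mul_mem_graded (A := fun i : ℕ => ⋀[ℂ]^i (S.E x.1)) hm' (ih hn)
      rwa [add_comm] at this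
    · exact fun _ _ h1 h2 => add_mem h1 h2

/-- Every section of `⋀^• E` is locally a finite sum of homogeneous sections. -/
theorem exists_hom {U : Opens S.X} (s : S.extSec U) {x : S.X} (hx : x ∈ U) :
    ∃ (V : Opens S.X) (h : V ≤ U) (f : ℕ →₀ S.RawSec V), x ∈ V ∧ (∀ j, f j ∈ S.homSec V j) ∧
      (f.sum fun _ a => a) = (res h s).1 := by
  obtain ⟨V, h, hxV, hp⟩ := s.2 x hx
  obtain ⟨f, hf, hs⟩ := (Submodule.mem_iSup_iff_exists_finsupp _ _).1 (polySec_le_hom V hp)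
  exact ⟨V, h, f, hxV, hf, hs⟩

theorem hom_proj {V : Opens S.X} (f : ℕ →₀ S.RawSec V) (hf : ∀ j, f j ∈ S.homSec V j) (j : ℕ)
    (x : V) : GradedRing.proj (fun i : ℕ => ⋀[ℂ]^i (S.E x.1)) j
      ((f.sum fun _ a => a) x) = f j x := by
  rw [Finsupp.sum, Finset.sum_apply, map_sum]
  by_cases hj : j ∈ f.support
  · rw [Finset.sum_eq_single_of_mem j hj]
    · exact proj_same (homSec_deg V j (hf j) x)
    · exact fun i _ hi => proj_ne hi (homSec_deg V i (hf i) x)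
  · rw [Finset.sum_eq_zero fun i hi => proj_ne (by rintro rfl; exact hj hi) (homSec_deg V i (hf i) x)]
    rw [Finsupp.notMem_support_iff.1 hj]
    rfl

theorem green_hom {U V : Opens S.X} (hV : V ≤ U) {α : SuperAut S U} (hα : α ∈ S.greenSub 2 U)
    (j : ℕ) {p : S.RawSec V} (hp : p ∈ S.homSec V j) :
    ∃ h : p ∈ S.extSec V, InFilt (j + 1) (α.app V hV ⟨p, h⟩ - ⟨p, h⟩) := by
  refine ⟨S.polySec_le V (homSec_le V j hp), ?_⟩
  suffices H : ∃ h : p ∈ S.extSec V, InFilt (j + 1) (α.app V hV ⟨p, h⟩ - ⟨p, h⟩) from H.2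
  induction j generalizing p with
  | zero =>
    exact ⟨S.polySec_le V (homSec_le V 0 hp), fun x => extFilt_anti (by omega) (hα V hV _ x)⟩
  | succ j ih =>
    refine Submodule.mul_induction_on
      (C := fun p => ∃ h : p ∈ S.extSec V, InFilt (j + 1 + 1) (α.app V hV ⟨p, h⟩ - ⟨p, h⟩)) hp
      ?_ ?_
    · intro m hm n hn
      have hm1 : m ∈ S.homSec V 1 := by
        have := Submodule.mul_mem_mul hm (const_mem V 1)
        rwa [map_one, mul_one] at this
      have hm' := S.polySec_le V (homSec_le V 1 hm1)
      obtain ⟨hn', h⟩ := ih hn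
      refine ⟨mul_mem hm' hn', fun x => ?_⟩
      have e : α.app V hV ⟨m * n, mul_mem hm' hn'⟩ - ⟨m * n, mul_mem hm' hn'⟩ =
          α.app V hV ⟨m, hm'⟩ * (α.app V hV ⟨n, hn'⟩ - ⟨n, hn'⟩) +
          (α.app V hV ⟨m, hm'⟩ - ⟨m, hm'⟩) * ⟨n, hn'⟩ := by
        have : (⟨m * n, mul_mem hm' hn'⟩ : S.extSec V) = ⟨m, hm'⟩ * ⟨n, hn'⟩ := rfl
        rw [this, map_mul, mul_sub, sub_mul]
        abel
      rw [e]
      have h2 := hα V hV ⟨m, hm'⟩ x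
      have h1 : (α.app V hV ⟨m, hm'⟩).1 x ∈ extFilt (S.E x.1) 1 := by
        have := add_mem (extFilt_anti one_le_two h2) (mem_extFilt le_rfl (homSec_deg V 1 hm1 x))
        simpa using this
      have a1 := extFilt_mul h1 (h x)
      have a2 := extFilt_mul h2 (mem_extFilt le_rfl (homSec_deg V j hn x))
      rw [show 1 + (j + 1) = j + 1 + 1 by omega] at a1
      rw [show 2 + j = j + 1 + 1 by omega] at a2
      exact add_mem a1 a2
    · rintro p q ⟨hp, hp'⟩ ⟨hq, hq'⟩
      refine ⟨add_mem hp hq, fun x => ?_⟩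
      have e : α.app V hV ⟨p + q, add_mem hp hq⟩ - ⟨p + q, add_mem hp hq⟩ =
          (α.app V hV ⟨p, hp⟩ - ⟨p, hp⟩) + (α.app V hV ⟨q, hq⟩ - ⟨q, hq⟩) := by
        have : (⟨p + q, add_mem hp hq⟩ : S.extSec V) = ⟨p, hp⟩ + ⟨q, hq⟩ := rfl
        rw [this, map_add]
        abel
      rw [e]
      exact add_mem (hp' x) (hq' x)

theorem green_filt {U V : Opens S.X} (hV : V ≤ U) {α : SuperAut S U} (hα : α ∈ S.greenSub 2 U)
    (m : ℕ) {s : S.extSec V} (hs : InFilt m s) : InFilt (m + 1) (α.app V hV s - s) := by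
  intro x
  obtain ⟨W, h, f, hx, hf, hfs⟩ := exists_hom s x.2
  have hmem : ∀ j, f j ∈ S.extSec W := fun j => S.polySec_le W (homSec_le W j (hf j))
  have e : res h s = ∑ j ∈ f.support, ⟨f j, hmem j⟩ := by
    apply Subtype.ext
    rw [← hfs, Finsupp.sum, AddSubmonoidClass.coe_finsetSum]
  have key : InFilt (m + 1) (α.app W (h.trans hV) (res h s) - res h s) := by
    intro y
    rw [e, map_sum, ← Finset.sum_sub_distrib, AddSubmonoidClass.coe_finsetSum, Finset.sum_apply]
    refine sum_mem fun j _ => ?_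
    by_cases hj : j < m
    · have : f j = 0 := by
        funext z
        rw [← hom_proj f hf j z, hfs]
        exact extFilt_proj hj (hs ⟨z.1, h z.2⟩)
      have e0 : (⟨f j, hmem j⟩ : S.extSec W) = 0 := Subtype.ext this
      rw [e0]
      simp
    · obtain ⟨_, h'⟩ := green_hom (h.trans hV) hα j (hf j)
      exact extFilt_anti (by omega) (h' y)
  have := key ⟨x.1, hx⟩
  rw [← α.res_app V W hV h, ← map_sub] at this
  exact this

/-- Commutators of elements of `𝒢⁽ᵏ⁾` lie in `𝒢⁽ᵏ⁺¹⁾` if `k ≥ 2`. -/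
theorem green_comm {k : ℕ} (hk : 2 ≤ k) {U : Opens S.X} {α β : SuperAut S U}
    (hα : α ∈ S.greenSub k U) (hβ : β ∈ S.greenSub k U) :
    α * β * α⁻¹ * β⁻¹ ∈ S.greenSub (k + 1) U := by
  intro V hV s x
  obtain ⟨w, rfl⟩ : ∃ w, s = β.app V hV (α.app V hV w) :=
    ⟨(α⁻¹).app V hV ((β⁻¹).app V hV s), by simp⟩
  have ha := green_filt hV (S.greenSub_anti hk U hα) k (hβ V hV w) x
  have hb := green_filt hV (S.greenSub_anti hk U hβ) k (hα V hV w) x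
  have := sub_mem ha hb
  convert this using 1
  simp
  abel

end Supergeometry

/-! ### Embeddings of supergeometries -/

/-- A holomorphic embedding of the supergeometry `Y` in the supergeometry `S`: a holomorphic
embedding `i` of complex manifolds and a surjective morphism `T_S → i_* T_Y` of the sheaves of
holomorphic sections of the odd conormal bundles, linear over holomorphic functions.  Such a
morphism is given by a holomorphic family of linear maps `φ y : (E_S)_{i y} → (E_Y)_y`. -/
structure SuperEmbedding (Y S : Supergeometry.{u}) where
  i : Y.X → S.X
  embedding : Manifold.IsSmoothEmbedding 𝓘(ℂ, Y.Model) 𝓘(ℂ, S.Model) ω i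
  φ : ∀ y, S.E (i y) →ₗ[ℂ] Y.E y
  /-- the family `φ` maps holomorphic sections to holomorphic sections -/
  holo : ∀ (U : Opens S.X) (σ : ∀ x, S.E x), S.HolSec U σ →
    ∀ V : Opens Y.X, (∀ y ∈ V, i y ∈ U) → Y.HolSec V fun y => φ y (σ (i y))
  /-- surjectivity as a morphism of sheaves on `S.X` -/
  surj : ∀ (U : Opens S.X) (V : Opens Y.X), (∀ y, y ∈ V ↔ i y ∈ U) →
    ∀ τ : (∀ y, Y.E y), Y.HolSec V τ → ∀ x ∈ U, ∃ (U' : Opens S.X) (σ : ∀ x, S.E x),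
      x ∈ U' ∧ U' ≤ U ∧ S.HolSec U' σ ∧ ∀ y, i y ∈ U' → φ y (σ (i y)) = τ y

namespace SuperEmbedding

open Supergeometry

variable {Y S : Supergeometry.{u}} (f : SuperEmbedding Y S)

theorem continuous : Continuous f.i := f.embedding.contMDiff.continuous

/-- The underlying continuous map. -/
def cmap : C(Y.X, S.X) := ⟨f.i, f.continuous⟩

/-- The inverse image of an open set. -/
abbrev pre (U : Opens S.X) : Opens Y.X := Opens.comap f.cmap U

theorem pre_mono {U V : Opens S.X} (h : V ≤ U) : f.pre V ≤ f.pre U := fun _ hy => h hy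

/-- Every neighbourhood of `y` contains the inverse image of a neighbourhood of `i y`. -/
theorem exists_pre_le (W : Opens Y.X) {y : Y.X} (hy : y ∈ W) :
    ∃ V : Opens S.X, f.i y ∈ V ∧ f.pre V ≤ W := by
  obtain ⟨t, ht, e⟩ := f.embedding.isEmbedding.isInducing.isOpen_iff.1 W.isOpen
  refine ⟨⟨t, ht⟩, ?_, ?_⟩
  · have : y ∈ f.i ⁻¹' t := e ▸ hy
    exact this
  · intro z hz
    have : z ∈ f.i ⁻¹' t := hz
    rw [e] at this
    exact this

/-- Holomorphic functions on `Y` extend locally to `S`. -/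
theorem lift_fun {W : Opens Y.X} {g : Y.X → ℂ} (hg : Y.HolFun W g) {y : Y.X} (hy : y ∈ W) :
    ∃ (V : Opens S.X) (h : S.X → ℂ), f.i y ∈ V ∧ f.pre V ≤ W ∧ S.HolFun V h ∧
      ∀ z ∈ f.pre V, h (f.i z) = g z := by
  have im := f.embedding.isImmersion.isImmersionAt y
  let d := im.domChart
  let c := im.codChart
  let r : S.X → Y.Model := fun x => (im.equiv.symm (c x)).1
  have hr : ContMDiffOn 𝓘(ℂ, S.Model) 𝓘(ℂ, Y.Model) ω r c.source := by
    have h1 := contMDiffOn_of_mem_maximalAtlas im.codChart_mem_maximalAtlas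
    have h2 : ContMDiff 𝓘(ℂ, S.Model) 𝓘(ℂ, Y.Model) ω
        (((ContinuousLinearMap.fst ℂ Y.Model im.complement).comp
          (im.equiv.symm : S.Model →L[ℂ] Y.Model × im.complement))) :=
      ContinuousLinearMap.contMDiff _
    exact h2.comp_contMDiffOn h1
  have hri : ∀ z ∈ d.source, r (f.i z) = d z := by
    intro z hz
    have hz' : d z ∈ (d.extend 𝓘(ℂ, Y.Model)).target := by
      simpa using d.map_source hz
    have := im.writtenInCharts hz'
    have e : (d.extend 𝓘(ℂ, Y.Model)).symm (d z) = z := by simpa using d.left_inv hz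
    simp only [Function.comp_apply] at this
    change c (f.i ((d.extend 𝓘(ℂ, Y.Model)).symm (d z))) = _ at this
    rw [e] at this
    simp only [r]
    rw [this]
    simp
  -- the open set on which the extension is defined
  have hO : IsOpen (c.source ∩ r ⁻¹' (d.target ∩ d.symm ⁻¹' W)) :=
    hr.continuousOn.isOpen_inter_preimage c.open_source
      (d.symm.continuousOn.isOpen_inter_preimage d.open_target W.isOpen)
  obtain ⟨V₀, hyV₀, hV₀⟩ := f.exists_pre_le (W ⊓ ⟨d.source, d.open_source⟩)
    ⟨hy, im.mem_domChart_source⟩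
  refine ⟨V₀ ⊓ ⟨_, hO⟩, fun x => g (d.symm (r x)), ⟨hyV₀, im.mem_codChart_source, ?_⟩, ?_, ?_, ?_⟩
  · have e := hri y im.mem_domChart_source
    refine ⟨?_, ?_⟩
    · rw [e]; exact d.map_source im.mem_domChart_source
    · change d.symm (r (f.i y)) ∈ W
      rw [e, d.left_inv im.mem_domChart_source]; exact hy
  · exact fun z hz => (hV₀ hz.1).1
  · have h1 := contMDiffOn_symm_of_mem_maximalAtlas im.domChart_mem_maximalAtlas
    have h2 : ContMDiffOn 𝓘(ℂ, S.Model) 𝓘(ℂ, Y.Model) ω (fun x => d.symm (r x))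
        (V₀ ⊓ ⟨_, hO⟩ : Opens S.X) :=
      h1.comp (hr.mono fun x hx => hx.2.1) fun x hx => hx.2.2.1
    exact ContMDiffOn.comp hg h2 fun x hx => hx.2.2.2
  · intro z hz
    have hz' : z ∈ d.source := (hV₀ hz.1).2
    simp only
    rw [hri z hz', d.left_inv hz']

/-- Pull-back of discontinuous sections. -/
def rawPull (U : Opens S.X) : S.RawSec U →ₐ[ℂ] Y.RawSec (f.pre U) :=
  AlgHom.pi fun y : f.pre U => (ExteriorAlgebra.map (f.φ y.1)).comp
    (Pi.evalAlgHom ℂ (fun x : U => ExteriorAlgebra ℂ (S.E x)) ⟨f.i y.1, y.2⟩)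

theorem rawPull_poly {U : Opens S.X} {p : S.RawSec U} (hp : p ∈ S.polySec U) :
    f.rawPull U p ∈ Y.polySec (f.pre U) := by
  have : (S.polySec U).map (f.rawPull U) ≤ Y.polySec (f.pre U) := by
    rw [polySec, AlgHom.map_adjoin]
    refine Algebra.adjoin_mono ?_
    rintro _ ⟨p, ⟨g, hg, rfl⟩ | ⟨σ, hσ, rfl⟩, rfl⟩
    · refine Or.inl ⟨g ∘ f.i, ?_, ?_⟩
      · exact ContMDiffOn.comp hg f.embedding.contMDiff.contMDiffOn fun y hy => hy
      · funext y
        exact (ExteriorAlgebra.map (f.φ y.1)).commutes _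
    · refine Or.inr ⟨fun y => f.φ y (σ (f.i y)), f.holo U σ hσ _ fun y hy => hy, ?_⟩
      funext y
      exact ExteriorAlgebra.map_apply_ι _ _
  exact this ⟨p, hp, rfl⟩

/-- The morphism `⋀^• E_S → i_* ⋀^• E_Y` of sheaves of algebras on `S.X`. -/
def pull (U : Opens S.X) : S.extSec U →ₐ[ℂ] Y.extSec (f.pre U) :=
  ((f.rawPull U).comp (S.extSec U).val).codRestrict (Y.extSec (f.pre U)) fun s y hy => by
    obtain ⟨V, hV, hxV, hp⟩ := s.2 (f.i y) hy
    exact ⟨f.pre V, f.pre_mono hV, hxV, f.rawPull_poly hp⟩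

@[simp]
theorem pull_coe (U : Opens S.X) (s : S.extSec U) (y : f.pre U) :
    (f.pull U s).1 y = ExteriorAlgebra.map (f.φ y.1) (s.1 ⟨f.i y.1, y.2⟩) := rfl

theorem pull_res {U V : Opens S.X} (h : V ≤ U) (s : S.extSec U) :
    f.pull V (res h s) = res (f.pre_mono h) (f.pull U s) := rfl

/-- The sections over `U` of the sheaf of automorphisms of `⋀^• E_S` which preserve the kernel of
`⋀^• E_S → i_* ⋀^• E_Y`. -/
def presSub (U : Opens S.X) : Subgroup (SuperAut S U) where
  carrier := {α | ∀ (V : Opens S.X) (hV : V ≤ U) (s : S.extSec V),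
    f.pull V (α.app V hV s) = 0 ↔ f.pull V s = 0}
  one_mem' _ _ _ := Iff.rfl
  mul_mem' hα hβ V hV s := (hα V hV _).trans (hβ V hV s)
  inv_mem' {α} hα V hV s := by
    rw [← hα V hV]
    simp

/-- Sections of `⋀^• E_Y` lift locally to sections of `⋀^• E_S`. -/
theorem exists_lift {W : Opens Y.X} (s : Y.extSec W) {y : Y.X} (hy : y ∈ W) :
    ∃ (V : Opens S.X) (h : f.pre V ≤ W) (t : S.extSec V), f.i y ∈ V ∧ f.pull V t = res h s := by
  obtain ⟨W', hW', hyW', hp⟩ := s.2 y hy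
  suffices H : ∃ (V : Opens S.X) (h : f.pre V ≤ W') (t : S.extSec V), f.i y ∈ V ∧
      (f.pull V t).1 = Y.rawRes h (Y.rawRes hW' s.1) by
    obtain ⟨V, h, t, hV, e⟩ := H
    exact ⟨V, h.trans hW', t, hV, Subtype.ext e⟩
  generalize Y.rawRes hW' s.1 = p at hp
  induction hp using Algebra.adjoin_induction with
  | mem p hp =>
    rcases hp with ⟨g, hg, rfl⟩ | ⟨τ, hτ, rfl⟩
    · obtain ⟨V, h, hV, hVW, hh, e⟩ := f.lift_fun hg hyW'
      refine ⟨V, hVW, ⟨_, S.polySec_le V (Algebra.subset_adjoin (Or.inl ⟨h, hh, rfl⟩))⟩, hV, ?_⟩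
      funext z
      rw [pull_coe, AlgHom.commutes, e z.1 z.2]
      rfl
    · obtain ⟨V₀, hV₀, hVW⟩ := f.exists_pre_le W' hyW'
      obtain ⟨V, σ, hV, hle, hσ, e⟩ := f.surj V₀ (f.pre V₀) (fun _ => Iff.rfl) τ (hτ.mono hVW) _ hV₀
      refine ⟨V, (f.pre_mono hle).trans hVW,
        ⟨_, S.polySec_le V (Algebra.subset_adjoin (Or.inr ⟨σ, hσ, rfl⟩))⟩, hV, ?_⟩
      funext z
      rw [pull_coe, ExteriorAlgebra.map_apply_ι, e z.1 z.2]
      rfl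
  | algebraMap c =>
    obtain ⟨V, hV, hVW⟩ := f.exists_pre_le W' hyW'
    refine ⟨V, hVW, algebraMap ℂ _ c, hV, ?_⟩
    rw [AlgHom.commutes]
    rfl
  | add p q _ _ hp hq =>
    obtain ⟨V, h, t, hV, e⟩ := hp
    obtain ⟨V', h', t', hV', e'⟩ := hq
    refine ⟨V ⊓ V', (f.pre_mono inf_le_left).trans h,
      res inf_le_left t + res inf_le_right t', ⟨hV, hV'⟩, ?_⟩
    rw [map_add, pull_res, pull_res]
    funext z
    exact congrArg₂ (· + ·) (congrFun e ⟨z.1, z.2.1⟩) (congrFun e' ⟨z.1, z.2.2⟩)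
  | mul p q _ _ hp hq =>
    obtain ⟨V, h, t, hV, e⟩ := hp
    obtain ⟨V', h', t', hV', e'⟩ := hq
    refine ⟨V ⊓ V', (f.pre_mono inf_le_left).trans h,
      res inf_le_left t * res inf_le_right t', ⟨hV, hV'⟩, ?_⟩
    rw [map_mul, pull_res, pull_res]
    funext z
    exact congrArg₂ (· * ·) (congrFun e ⟨z.1, z.2.1⟩) (congrFun e' ⟨z.1, z.2.2⟩)

variable {f}

/-- `s'` is locally obtained from `s` by lifting `s` to `S`, applying `α` and pulling back. -/
def Rel {U : Opens S.X} (α : SuperAut S U) {W : Opens Y.X} (s s' : Y.extSec W) : Prop :=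
  ∀ y ∈ W, ∃ (V : Opens S.X) (hV : V ≤ U) (h : f.pre V ≤ W) (t : S.extSec V),
    f.i y ∈ V ∧ f.pull V t = res h s ∧ f.pull V (α.app V hV t) = res h s'

theorem pres_congr {U V : Opens S.X} {α : SuperAut S U} (hα : α ∈ f.presSub U) (hV : V ≤ U)
    {t t' : S.extSec V} (h : f.pull V t = f.pull V t') :
    f.pull V (α.app V hV t) = f.pull V (α.app V hV t') := by
  rw [← sub_eq_zero, ← map_sub, ← map_sub]
  rw [hα V hV, map_sub, h, sub_self]

/-- Two lifts can be compared on the intersection of their domains. -/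
theorem pres_congr' {U V V' : Opens S.X} {α : SuperAut S U} (hα : α ∈ f.presSub U) (hV : V ≤ U)
    (hV' : V' ≤ U) {W : Opens Y.X} {s : Y.extSec W} {h : f.pre V ≤ W} {h' : f.pre V' ≤ W}
    {t : S.extSec V} {t' : S.extSec V'} (e : f.pull V t = res h s) (e' : f.pull V' t' = res h' s) :
    f.pull (V ⊓ V') (α.app (V ⊓ V') (inf_le_left.trans hV) (res inf_le_left t)) =
      res (f.pre_mono inf_le_right) (f.pull V' (α.app V' hV' t')) := by
  have h0 : f.pull (V ⊓ V') (res inf_le_left t) = f.pull (V ⊓ V') (res inf_le_right t') := by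
    rw [pull_res, pull_res, e, e']
    rfl
  rw [pres_congr hα _ h0, ← α.res_app V' (V ⊓ V') hV' inf_le_right t', pull_res]

theorem Rel.unique {U : Opens S.X} {α : SuperAut S U} (hα : α ∈ f.presSub U) {W : Opens Y.X}
    {s s' s'' : Y.extSec W} (h1 : Rel (f := f) α s s') (h2 : Rel (f := f) α s s'') : s' = s'' := by
  apply Subtype.ext
  funext y
  obtain ⟨V, hV, h, t, hy, e1, e2⟩ := h1 y.1 y.2
  obtain ⟨V', hV', h', t', hy', e1', e2'⟩ := h2 y.1 y.2
  have key := pres_congr' hα hV hV' e1 e1'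
  rw [← α.res_app V (V ⊓ V') hV inf_le_left t, pull_res, e2, e2'] at key
  exact congrFun (congrArg Subtype.val key) ⟨y.1, hy, hy'⟩

theorem Rel.exists {U : Opens S.X} {α : SuperAut S U} (hα : α ∈ f.presSub U) {W : Opens Y.X}
    (hW : W ≤ f.pre U) (s : Y.extSec W) : ∃ s', Rel (f := f) α s s' := by
  have H : ∀ y : W, ∃ (V : Opens S.X) (_ : V ≤ U) (h : f.pre V ≤ W) (t : S.extSec V),
      f.i y ∈ V ∧ f.pull V t = res h s := by
    intro y
    obtain ⟨V, h, t, hy, e⟩ := f.exists_lift s y.2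
    exact ⟨V ⊓ U, inf_le_right, (f.pre_mono inf_le_left).trans h, res inf_le_left t,
      ⟨hy, hW y.2⟩, by rw [pull_res, e]; rfl⟩
  choose V hV h t hy e using H
  let p : Y.RawSec W := fun y => (f.pull (V y) (α.app (V y) (hV y) (t y))).1 ⟨y.1, hy y⟩
  have hp : ∀ y : W, Y.rawRes (h y) p = (f.pull (V y) (α.app (V y) (hV y) (t y))).1 := by
    intro y
    funext z
    let z' : W := ⟨z.1, h y z.2⟩
    have key := pres_congr' hα (hV z') (hV y) (e z') (e y)
    rw [← α.res_app (V z') _ (hV z') inf_le_left, pull_res] at key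
    exact congrFun (congrArg Subtype.val key) ⟨z.1, hy z', z.2⟩
  have hmem : p ∈ Y.extSec W := by
    intro y hyW
    obtain ⟨W', hW', hyW', hq⟩ :=
      (f.pull (V ⟨y, hyW⟩) (α.app _ (hV ⟨y, hyW⟩) (t ⟨y, hyW⟩))).2 y (hy ⟨y, hyW⟩)
    rw [← hp ⟨y, hyW⟩] at hq
    exact ⟨W', hW'.trans (h ⟨y, hyW⟩), hyW', hq⟩
  exact ⟨⟨p, hmem⟩, fun y hyW => ⟨V ⟨y, hyW⟩, hV _, h _, t _, hy _, e _,
    Subtype.ext (hp ⟨y, hyW⟩).symm⟩⟩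

theorem Rel.symm {U : Opens S.X} {α : SuperAut S U} {W : Opens Y.X} {s s' : Y.extSec W}
    (h : Rel (f := f) α s s') : Rel (f := f) α⁻¹ s' s := by
  intro y hy
  obtain ⟨V, hV, h, t, hyV, e1, e2⟩ := h y hy
  exact ⟨V, hV, h, α.app V hV t, hyV, e2, by simpa using e1⟩

theorem Rel.mul {U : Opens S.X} {α β : SuperAut S U} (hα : α ∈ f.presSub U) {W : Opens Y.X}
    {s s' s'' : Y.extSec W} (h1 : Rel (f := f) β s s') (h2 : Rel (f := f) α s' s'') :
    Rel (f := f) (α * β) s s'' := by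
  intro y hy
  obtain ⟨V, hV, h, t, hyV, e1, e2⟩ := h1 y hy
  obtain ⟨V', hV', h', t', hyV', e1', e2'⟩ := h2 y hy
  refine ⟨V ⊓ V', inf_le_left.trans hV, (f.pre_mono inf_le_left).trans h, res inf_le_left t,
    ⟨hyV, hyV'⟩, by rw [pull_res, e1]; rfl, ?_⟩
  rw [SuperAut.mul_app_apply, ← β.res_app V (V ⊓ V') hV inf_le_left,
    pres_congr' hα hV hV' e2 e1', e2']
  rfl

/-- Binary operations compatible with everything in sight preserve the relation. -/
theorem Rel.binop {U : Opens S.X} {α : SuperAut S U} {W : Opens Y.X}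
    {s₁ s₁' s₂ s₂' : Y.extSec W} (h1 : Rel (f := f) α s₁ s₁') (h2 : Rel (f := f) α s₂ s₂') :
    Rel (f := f) α (s₁ + s₂) (s₁' + s₂') ∧ Rel (f := f) α (s₁ * s₂) (s₁' * s₂') := by
  have H : ∀ y ∈ W, ∃ (V : Opens S.X) (hV : V ≤ U) (h : f.pre V ≤ W) (t₁ t₂ : S.extSec V),
      f.i y ∈ V ∧ (f.pull V t₁ = res h s₁ ∧ f.pull V (α.app V hV t₁) = res h s₁') ∧
        (f.pull V t₂ = res h s₂ ∧ f.pull V (α.app V hV t₂) = res h s₂') := by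
    intro y hy
    obtain ⟨V, hV, h, t, hyV, e1, e2⟩ := h1 y hy
    obtain ⟨V', hV', h', t', hyV', e1', e2'⟩ := h2 y hy
    refine ⟨V ⊓ V', inf_le_left.trans hV, (f.pre_mono inf_le_left).trans h, res inf_le_left t,
      res inf_le_right t', ⟨hyV, hyV'⟩, ⟨by rw [pull_res, e1]; rfl, ?_⟩,
      ⟨by rw [pull_res, e1']; rfl, ?_⟩⟩
    · rw [← α.res_app V (V ⊓ V') hV inf_le_left, pull_res, e2]; rfl
    · rw [← α.res_app V' (V ⊓ V') hV' inf_le_right, pull_res, e2']; rfl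
  constructor
  · intro y hy
    obtain ⟨V, hV, h, t₁, t₂, hyV, ⟨a, b⟩, c, d⟩ := H y hy
    exact ⟨V, hV, h, t₁ + t₂, hyV, by rw [map_add, map_add, a, c],
      by rw [map_add, map_add, map_add, b, d]⟩
  · intro y hy
    obtain ⟨V, hV, h, t₁, t₂, hyV, ⟨a, b⟩, c, d⟩ := H y hy
    exact ⟨V, hV, h, t₁ * t₂, hyV, by rw [map_mul, map_mul, a, c],
      by rw [map_mul, map_mul, map_mul, b, d]⟩

theorem Rel.const {U : Opens S.X} (α : SuperAut S U) {W : Opens Y.X} (hW : W ≤ f.pre U) (c : ℂ) :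
    Rel (f := f) α (algebraMap ℂ (Y.extSec W) c) (algebraMap ℂ (Y.extSec W) c) := by
  intro y hy
  obtain ⟨V, hV, h⟩ := f.exists_pre_le W hy
  refine ⟨V ⊓ U, inf_le_right, (f.pre_mono inf_le_left).trans h, algebraMap ℂ _ c,
    ⟨hV, hW hy⟩, ?_, ?_⟩
  · rw [AlgHom.commutes, AlgHom.commutes]
  · rw [AlgEquiv.commutes, AlgHom.commutes, AlgHom.commutes]

theorem Rel.res {U : Opens S.X} {α : SuperAut S U} {W W' : Opens Y.X} (hW : W' ≤ W)
    {s s' : Y.extSec W} (h : Rel (f := f) α s s') :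
    Rel (f := f) α (Supergeometry.res hW s) (Supergeometry.res hW s') := by
  intro y hy
  obtain ⟨V, hV, h, t, hyV, e1, e2⟩ := h y (hW hy)
  obtain ⟨V', hV', h'⟩ := f.exists_pre_le W' hy
  refine ⟨V ⊓ V', inf_le_left.trans hV, (f.pre_mono inf_le_right).trans h',
    Supergeometry.res inf_le_left t, ⟨hyV, hV'⟩, ?_, ?_⟩
  · rw [pull_res, e1]; rfl
  · rw [← α.res_app V (V ⊓ V') hV inf_le_left, pull_res, e2]; rfl

theorem Rel.restr {U U' : Opens S.X} (hU : U' ≤ U) {α : SuperAut S U} {W : Opens Y.X}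
    {s s' : Y.extSec W} (h : Rel (f := f) (SuperAut.restr hU α) s s') : Rel (f := f) α s s' := by
  intro y hy
  obtain ⟨V, hV, h, t, hyV, e1, e2⟩ := h y hy
  exact ⟨V, hV.trans hU, h, t, hyV, e1, e2⟩

/-- A section of `⋀^• E` is locally the sum of an even and an odd section. -/
theorem exists_even_odd {U : Opens S.X} (s : S.extSec U) {x : S.X} (hx : x ∈ U) :
    ∃ (V : Opens S.X) (h : V ≤ U) (a b : S.extSec V), x ∈ V ∧ IsEven a ∧ IsOdd b ∧
      res h s = a + b := by
  classical
  obtain ⟨V, h, g, hxV, hg, e⟩ := exists_hom s hx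
  have hmem : ∀ j, g j ∈ S.extSec V := fun j => S.polySec_le V (homSec_le V j (hg j))
  refine ⟨V, h, ∑ j ∈ g.support with Even j, ⟨g j, hmem j⟩,
    ∑ j ∈ g.support with ¬ Even j, ⟨g j, hmem j⟩, hxV, ?_, ?_, ?_⟩
  · intro z
    rw [AddSubmonoidClass.coe_finsetSum, Finset.sum_apply]
    refine sum_mem fun j hj => ?_
    obtain ⟨k, rfl⟩ := (Finset.mem_filter.1 hj).2
    refine Submodule.mem_iSup_of_mem (p := fun j : ℕ => ⋀[ℂ]^(2 * j) (S.E z.1)) k ?_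
    rw [two_mul]
    exact homSec_deg V _ (hg _) z
  · intro z
    rw [AddSubmonoidClass.coe_finsetSum, Finset.sum_apply]
    refine sum_mem fun j hj => ?_
    obtain ⟨k, rfl⟩ := Nat.not_even_iff_odd.1 (Finset.mem_filter.1 hj).2
    exact Submodule.mem_iSup_of_mem (p := fun j : ℕ => ⋀[ℂ]^(2 * j + 1) (S.E z.1)) k
      (homSec_deg V _ (hg _) z)
  · rw [Finset.sum_filter_add_sum_filter_not]
    apply Subtype.ext
    rw [← e, Finsupp.sum, AddSubmonoidClass.coe_finsetSum]

theorem pull_even {V : Opens S.X} {t : S.extSec V} (h : IsEven t) : IsEven (f.pull V t) :=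
  fun y => ext_map_even _ (h ⟨f.i y.1, y.2⟩)

theorem pull_odd {V : Opens S.X} {t : S.extSec V} (h : IsOdd t) : IsOdd (f.pull V t) :=
  fun y => ext_map_odd _ (h ⟨f.i y.1, y.2⟩)

theorem Rel.even {U : Opens S.X} {α : SuperAut S U} (hα : α ∈ f.presSub U) {W : Opens Y.X}
    {s s' : Y.extSec W} (h : Rel (f := f) α s s') (hs : IsEven s) : IsEven s' := by
  intro y
  obtain ⟨V, hV, h, t, hyV, e1, e2⟩ := h y.1 y.2
  obtain ⟨V', hV', a, b, hyV', ha, hb, e⟩ := exists_even_odd t hyV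
  have h1 : f.pull V' (Supergeometry.res hV' t) = f.pull V' a := by
    rw [e, map_add]
    suffices H : f.pull V' b = 0 by rw [H, add_zero]
    apply Subtype.ext
    funext z
    refine eq_zero_of_even_odd ?_ (pull_odd hb z)
    have hz := hs ⟨z.1, h (f.pre_mono hV' z.2)⟩
    have e3 : f.pull V' b = f.pull V' (Supergeometry.res hV' t) - f.pull V' a := by
      rw [e, map_add]; abel
    rw [e3, pull_res, e1]
    exact sub_mem hz (pull_even ha z)
  have h2 := pres_congr hα (hV'.trans hV) h1
  rw [← α.res_app V V' hV hV', pull_res, e2] at h2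
  have h3 := pull_even (f := f) ((α.even_iff V' (hV'.trans hV) a).2 ha) ⟨y.1, hyV'⟩
  rw [← h2] at h3
  exact h3

theorem Rel.odd {U : Opens S.X} {α : SuperAut S U} (hα : α ∈ f.presSub U) {W : Opens Y.X}
    {s s' : Y.extSec W} (h : Rel (f := f) α s s') (hs : IsOdd s) : IsOdd s' := by
  intro y
  obtain ⟨V, hV, h, t, hyV, e1, e2⟩ := h y.1 y.2
  obtain ⟨V', hV', a, b, hyV', ha, hb, e⟩ := exists_even_odd t hyV
  have h1 : f.pull V' (Supergeometry.res hV' t) = f.pull V' b := by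
    rw [e, map_add]
    suffices H : f.pull V' a = 0 by rw [H, zero_add]
    apply Subtype.ext
    funext z
    refine eq_zero_of_even_odd (pull_even ha z) ?_
    have hz := hs ⟨z.1, h (f.pre_mono hV' z.2)⟩
    have e3 : f.pull V' a = f.pull V' (Supergeometry.res hV' t) - f.pull V' b := by
      rw [e, map_add]; abel
    rw [e3, pull_res, e1]
    exact sub_mem hz (pull_odd hb z)
  have h2 := pres_congr hα (hV'.trans hV) h1
  rw [← α.res_app V V' hV hV', pull_res, e2] at h2
  have h3 := pull_odd (f := f) ((α.odd_iff V' (hV'.trans hV) b).2 hb) ⟨y.1, hyV'⟩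
  rw [← h2] at h3
  exact h3

section

variable {U : Opens S.X}

/-- The action on sections of the restriction of `α` to the submanifold. -/
noncomputable def restrictFun (α : f.presSub U) {W : Opens Y.X} (hW : W ≤ f.pre U)
    (s : Y.extSec W) : Y.extSec W :=
  (Rel.exists α.2 hW s).choose

theorem restrictFun_rel (α : f.presSub U) {W : Opens Y.X} (hW : W ≤ f.pre U) (s : Y.extSec W) :
    Rel (f := f) α.1 s (restrictFun α hW s) :=
  (Rel.exists α.2 hW s).choose_spec

theorem restrictFun_eq {α : f.presSub U} {W : Opens Y.X} (hW : W ≤ f.pre U) {s s' : Y.extSec W}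
    (h : Rel (f := f) α.1 s s') : restrictFun α hW s = s' :=
  (restrictFun_rel α hW s).unique α.2 h

/-- The restriction to the submanifold `Y` of an automorphism of `⋀^• E_S` over `U` which preserves
the kernel of `⋀^• E_S → i_* ⋀^• E_Y`: the automorphism induced on `⋀^• E_Y`. -/
noncomputable def restrictAut (α : f.presSub U) : SuperAut Y (f.pre U) where
  app W hW :=
    { toFun := restrictFun α hW
      invFun := restrictFun α⁻¹ hW
      left_inv := fun s => restrictFun_eq hW (restrictFun_rel α hW s).symm
      right_inv := fun s => restrictFun_eq hW (by
        have := (restrictFun_rel α⁻¹ hW s).symm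
        rwa [Subgroup.coe_inv, inv_inv] at this)
      map_mul' := fun s s' => restrictFun_eq hW
        (Rel.binop (restrictFun_rel α hW s) (restrictFun_rel α hW s')).2
      map_add' := fun s s' => restrictFun_eq hW
        (Rel.binop (restrictFun_rel α hW s) (restrictFun_rel α hW s')).1
      commutes' := fun c => restrictFun_eq hW (Rel.const α.1 hW c) }
  res_app W W' hW h s := (restrictFun_eq (h.trans hW) ((restrictFun_rel α hW s).res h)).symm
  even_iff W hW s := ⟨fun h => by
      have := (restrictFun_rel α hW s).symm
      exact this.even (inv_mem α.2) h, fun h => (restrictFun_rel α hW s).even α.2 h⟩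
  odd_iff W hW s := ⟨fun h => by
      have := (restrictFun_rel α hW s).symm
      exact this.odd (inv_mem α.2) h, fun h => (restrictFun_rel α hW s).odd α.2 h⟩

/-- The restriction of `α` is compatible with `α` under `⋀^• E_S → i_* ⋀^• E_Y`. -/
theorem restrictAut_pull (α : f.presSub U) {V : Opens S.X} (hV : V ≤ U) (t : S.extSec V) :
    (restrictAut α).app (f.pre V) (f.pre_mono hV) (f.pull V t) = f.pull V (α.1.app V hV t) :=
  restrictFun_eq (f.pre_mono hV) fun _ hy => ⟨V, hV, le_rfl, t, hy, rfl, rfl⟩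

variable (f U) in
/-- The restriction to the submanifold `Y` as a homomorphism of groups. -/
noncomputable def restrictHom : f.presSub U →* SuperAut Y (f.pre U) where
  toFun := restrictAut
  map_one' := by
    ext W hW s : 4
    refine restrictFun_eq hW fun y hy => ?_
    obtain ⟨V, h, t, hyV, e⟩ := f.exists_lift s hy
    exact ⟨V ⊓ U, inf_le_right, (f.pre_mono inf_le_left).trans h, res inf_le_left t,
      ⟨hyV, hW hy⟩, by rw [pull_res, e]; rfl, by
        rw [Subgroup.coe_one, SuperAut.one_app_apply, pull_res, e]; rfl⟩
  map_mul' α β := by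
    ext W hW s : 4
    exact restrictFun_eq hW
      ((restrictFun_rel β hW s).mul α.2 (restrictFun_rel α hW _))

theorem restrictHom_green {k : ℕ} {α : f.presSub U} (hα : α.1 ∈ S.greenSub k U) :
    restrictHom f U α ∈ Y.greenSub k (f.pre U) := by
  intro W hW s y
  obtain ⟨V, hV, h, t, hyV, e1, e2⟩ := restrictFun_rel α hW s y.1 y.2
  have := ext_map_filt (f.φ y.1) (hα V hV t ⟨f.i y.1, hyV⟩)
  have e : (f.pull V (α.1.app V hV t - t)).1 ⟨y.1, hyV⟩ =
      (((restrictHom f U) α).app W hW s - s).1 y := by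
    rw [map_sub, e1, e2]
    rfl
  rw [← e]
  exact this

theorem restrictHom_restr {U' : Opens S.X} (hU : U' ≤ U) (α : f.presSub U)
    (h : SuperAut.restr hU α.1 ∈ f.presSub U') :
    restrictHom f U' ⟨SuperAut.restr hU α.1, h⟩ =
      SuperAut.restr (f.pre_mono hU) (restrictHom f U α) := by
  ext W hW s : 4
  exact (restrictFun_eq (hW.trans (f.pre_mono hU))
    (restrictFun_rel ⟨SuperAut.restr hU α.1, h⟩ hW s).restr).symm

end

end SuperEmbedding

/-! ### Čech cohomology of presheaves of groups -/

section Cech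

variable {X : Type u} [TopologicalSpace X]

variable (X) in
/-- An open cover of a topological space. -/
structure OpenCover where
  /-- the index set -/
  I : Type u
  /-- the members of the cover -/
  U : I → Opens X
  covers : ∀ x, ∃ i, x ∈ U i

/-- A refinement of open covers: each member of `𝒲` is contained in the member of `𝒰` with the
assigned index. -/
structure Refinement (𝒲 𝒰 : OpenCover X) where
  idx : 𝒲.I → 𝒰.I
  le : ∀ i, 𝒲.U i ≤ 𝒰.U (idx i)

/-- The cover by the pairwise intersections. -/
def OpenCover.inf (𝒰 𝒱 : OpenCover X) : OpenCover X where
  I := 𝒰.I × 𝒱.I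
  U p := 𝒰.U p.1 ⊓ 𝒱.U p.2
  covers x := by
    obtain ⟨i, hi⟩ := 𝒰.covers x
    obtain ⟨j, hj⟩ := 𝒱.covers x
    exact ⟨(i, j), hi, hj⟩

/-- Čech 1-cocycles with values in `G` on the cover `𝒰`. -/
abbrev CechCocycle (G : (Opens X)ᵒᵖ ⥤ GrpCat.{u}) (𝒰 : OpenCover X) :=
  PresheafOfGroups.OneCocycle G 𝒰.U

namespace CechCocycle

variable {G G' G'' : (Opens X)ᵒᵖ ⥤ GrpCat.{u}}

/-- The restriction of a cocycle to a refinement. -/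
def refine {𝒰 𝒲 : OpenCover X} (τ : Refinement 𝒲 𝒰) (γ : CechCocycle G 𝒰) : CechCocycle G 𝒲 where
  ev i j _ a b := γ.ev (τ.idx i) (τ.idx j) (a ≫ homOfLE (τ.le i)) (b ≫ homOfLE (τ.le j))
  ev_precomp i j _ _ φ a b := by simp
  ev_trans i j k _ a b c := γ.ev_trans _ _ _ _ _ _

theorem refine_coh {𝒰 𝒲 : OpenCover X} (τ : Refinement 𝒲 𝒰) {γ δ : CechCocycle G 𝒰}
    (h : γ.IsCohomologous δ) : (refine τ γ).IsCohomologous (refine τ δ) := by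
  obtain ⟨α, hα⟩ := h
  refine ⟨fun i => G.map (homOfLE (τ.le i)).op (α (τ.idx i)), fun i j T a b => ?_⟩
  have := hα (τ.idx i) (τ.idx j) (a ≫ homOfLE (τ.le i)) (b ≫ homOfLE (τ.le j))
  simpa [refine] using this

theorem refine_two {𝒰 𝒲 : OpenCover X} (τ τ' : Refinement 𝒲 𝒰) (γ : CechCocycle G 𝒰) :
    (refine τ γ).IsCohomologous (refine τ' γ) := by
  refine ⟨fun i => γ.ev (τ'.idx i) (τ.idx i) (homOfLE (τ'.le i)) (homOfLE (τ.le i)),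
    fun i j T a b => ?_⟩
  simp only [refine, PresheafOfGroups.OneCochain.ev_precomp]
  rw [γ.ev_trans, γ.ev_trans]

/-- Two cocycles, on possibly different covers, define the same class if their restrictions to some
common refinement are cohomologous. -/
def Equiv (x y : Σ 𝒰 : OpenCover X, CechCocycle G 𝒰) : Prop :=
  ∃ (𝒲 : OpenCover X) (τ : Refinement 𝒲 x.1) (ρ : Refinement 𝒲 y.1),
    (refine τ x.2).IsCohomologous (refine ρ y.2)

theorem equiv_equivalence : Equivalence (Equiv (G := G)) where
  refl x := ⟨x.1, ⟨id, fun _ => le_rfl⟩, ⟨id, fun _ => le_rfl⟩,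
    (PresheafOfGroups.OneCocycle.equivalence_isCohomologous _ _).refl _⟩
  symm := fun ⟨𝒲, τ, ρ, h⟩ =>
    ⟨𝒲, ρ, τ, (PresheafOfGroups.OneCocycle.equivalence_isCohomologous _ _).symm h⟩
  trans := by
    rintro x y z ⟨𝒲, τ, ρ, h⟩ ⟨𝒲', τ', ρ', h'⟩
    have E := PresheafOfGroups.OneCocycle.equivalence_isCohomologous G (𝒲.inf 𝒲').U
    let p : Refinement (𝒲.inf 𝒲') 𝒲 := ⟨Prod.fst, fun _ => inf_le_left⟩
    let q : Refinement (𝒲.inf 𝒲') 𝒲' := ⟨Prod.snd, fun _ => inf_le_right⟩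
    refine ⟨𝒲.inf 𝒲', ⟨τ.idx ∘ p.idx, fun i => (p.le i).trans (τ.le _)⟩,
      ⟨ρ'.idx ∘ q.idx, fun i => (q.le i).trans (ρ'.le _)⟩, ?_⟩
    refine E.trans (refine_coh p h) (E.trans ?_ (refine_coh q h'))
    exact refine_two ⟨ρ.idx ∘ p.idx, fun i => (p.le i).trans (ρ.le _)⟩
      ⟨τ'.idx ∘ q.idx, fun i => (q.le i).trans (τ'.le _)⟩ y.2

/-- The image of a cocycle under a morphism of presheaves of groups. -/
def map (f : G ⟶ G') {𝒰 : OpenCover X} (γ : CechCocycle G 𝒰) : CechCocycle G' 𝒰 where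
  ev i j T a b := f.app (op T) (γ.ev i j a b)
  ev_precomp i j T T' φ a b := by
    rw [← PresheafOfGroups.OneCochain.ev_precomp, NatTrans.naturality_apply]
  ev_trans i j k T a b c := by rw [← map_mul, γ.ev_trans]

theorem map_coh (f : G ⟶ G') {𝒰 : OpenCover X} {γ δ : CechCocycle G 𝒰}
    (h : γ.IsCohomologous δ) : (map f γ).IsCohomologous (map f δ) := by
  obtain ⟨α, hα⟩ := h
  refine ⟨fun i => f.app _ (α i), fun i j T a b => ?_⟩
  have := congrArg (f.app (op T)) (hα i j a b)
  rw [map_mul, map_mul, NatTrans.naturality_apply, NatTrans.naturality_apply] at this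
  exact this

end CechCocycle

/-- Equivalence of cocycles on varying covers. -/
instance cechSetoid (G : (Opens X)ᵒᵖ ⥤ GrpCat.{u}) : Setoid (Σ 𝒰 : OpenCover X, CechCocycle G 𝒰) :=
  ⟨CechCocycle.Equiv, CechCocycle.equiv_equivalence⟩

/-- The Čech cohomology set `Ȟ¹(X, G)` of a presheaf of groups: the colimit over all open covers of
the cohomology sets of the covers. -/
def CechH1 (G : (Opens X)ᵒᵖ ⥤ GrpCat.{u}) : Type (u + 1) := Quotient (cechSetoid G)

namespace CechH1

variable {G G' : (Opens X)ᵒᵖ ⥤ GrpCat.{u}}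

variable (G) in
/-- The basepoint of `Ȟ¹(X, G)`: the class of the trivial cocycle. -/
def basepoint : CechH1 G :=
  Quotient.mk _ ⟨⟨PUnit, fun _ => ⊤, fun _ => ⟨⟨⟩, trivial⟩⟩, 1⟩

/-- The map `Ȟ¹(X, G) → Ȟ¹(X, G')` induced by a morphism of presheaves of groups. -/
def map (f : G ⟶ G') : CechH1 G → CechH1 G' :=
  Quotient.map (fun x => ⟨x.1, CechCocycle.map f x.2⟩) fun _ _ ⟨𝒲, τ, ρ, h⟩ =>
    ⟨𝒲, τ, ρ, CechCocycle.map_coh f h⟩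

variable {Y : Type u} [TopologicalSpace Y] (i : C(Y, X))

/-- The inverse image of an open cover. -/
def _root_.OpenCover.comap (𝒰 : OpenCover X) : OpenCover Y where
  I := 𝒰.I
  U j := Opens.comap i (𝒰.U j)
  covers y := 𝒰.covers (i y)

/-- The inverse image functor on open sets. -/
abbrev preim : Opens X ⥤ Opens Y := (OrderHomClass.mono (Opens.comap i)).functor

theorem _root_.CechCocycle.map_ev {H : (Opens Y)ᵒᵖ ⥤ GrpCat.{u}} {𝒰 : OpenCover X}
    (γ : CechCocycle ((preim i).op ⋙ H) 𝒰) {j k : 𝒰.I} {T : Opens Y} {A B : Opens X}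
    (hA : T ≤ (preim i).obj A) (hB : T ≤ (preim i).obj B) (h : B ≤ A)
    (a : A ⟶ 𝒰.U j) (b : A ⟶ 𝒰.U k) :
    H.map (homOfLE hA).op (γ.ev j k a b) =
      H.map (homOfLE hB).op (γ.ev j k (homOfLE h ≫ a) (homOfLE h ≫ b)) := by
  rw [← γ.ev_precomp j k (homOfLE h) a b]
  change _ = H.map (homOfLE hB).op (H.map ((preim i).map (homOfLE h)).op (γ.ev j k a b))
  rw [← ConcreteCategory.comp_apply, ← H.map_comp]
  rfl

/-- A cocycle of the direct image `i_* H` on a cover of `X`, regarded as a cocycle of `H` on the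
inverse image cover of `Y`. -/
def _root_.CechCocycle.comap {H : (Opens Y)ᵒᵖ ⥤ GrpCat.{u}} {𝒰 : OpenCover X}
    (γ : CechCocycle ((preim i).op ⋙ H) 𝒰) : CechCocycle H (𝒰.comap i) where
  ev j k T a b :=
    H.map (homOfLE (le_inf (leOfHom a) (leOfHom b)) :
        T ⟶ (preim i).obj (𝒰.U j ⊓ 𝒰.U k)).op
      (γ.ev j k (T := 𝒰.U j ⊓ 𝒰.U k) (homOfLE inf_le_left) (homOfLE inf_le_right))
  ev_precomp j k T T' φ a b := by
    rw [← ConcreteCategory.comp_apply, ← H.map_comp]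
    rfl
  ev_trans j k l T a b c := by
    have hT : T ≤ (preim i).obj (𝒰.U j ⊓ 𝒰.U k ⊓ 𝒰.U l) :=
      le_inf (le_inf (leOfHom a) (leOfHom b)) (leOfHom c)
    have e1 := CechCocycle.map_ev i γ (j := j) (k := k) (A := 𝒰.U j ⊓ 𝒰.U k)
      (le_inf (leOfHom a) (leOfHom b)) hT inf_le_left (homOfLE inf_le_left) (homOfLE inf_le_right)
    have e2 := CechCocycle.map_ev i γ (j := k) (k := l) (A := 𝒰.U k ⊓ 𝒰.U l)
      (le_inf (leOfHom b) (leOfHom c)) hT (le_inf (inf_le_left.trans inf_le_right) inf_le_right)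
      (homOfLE inf_le_left) (homOfLE inf_le_right)
    have e3 := CechCocycle.map_ev i γ (j := j) (k := l) (A := 𝒰.U j ⊓ 𝒰.U l)
      (le_inf (leOfHom a) (leOfHom c)) hT (le_inf (inf_le_left.trans inf_le_left) inf_le_right)
      (homOfLE inf_le_left) (homOfLE inf_le_right)
    refine (congrArg₂ (· * ·) e1 e2).trans (((map_mul _ _ _).symm.trans ?_).trans e3.symm)
    exact congrArg (H.map (homOfLE hT).op) (γ.ev_trans j k l _ _ _)

theorem comap_coh {H : (Opens Y)ᵒᵖ ⥤ GrpCat.{u}} {𝒰 : OpenCover X}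
    {γ δ : CechCocycle ((preim i).op ⋙ H) 𝒰} (h : γ.IsCohomologous δ) :
    (CechCocycle.comap i γ).IsCohomologous (CechCocycle.comap i δ) := by
  obtain ⟨α, hα⟩ := h
  refine ⟨α, fun j k T a b => ?_⟩
  have := congrArg (H.map (homOfLE (le_inf (leOfHom a) (leOfHom b)) :
    T ⟶ (preim i).obj (𝒰.U j ⊓ 𝒰.U k)).op)
    (hα j k (T := 𝒰.U j ⊓ 𝒰.U k) (homOfLE inf_le_left) (homOfLE inf_le_right))
  erw [map_mul, map_mul] at this
  simp only [Functor.comp_map] at this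
  rw [← ConcreteCategory.comp_apply, ← H.map_comp, ← ConcreteCategory.comp_apply,
    ← H.map_comp] at this
  exact this

/-- The canonical map `Ȟ¹(X, i_* H) → Ȟ¹(Y, H)`, restricting cocycles to inverse image covers. -/
def comap (H : (Opens Y)ᵒᵖ ⥤ GrpCat.{u}) : CechH1 ((preim i).op ⋙ H) → CechH1 H :=
  Quotient.map (fun x => ⟨x.1.comap i, CechCocycle.comap i x.2⟩) fun x y ⟨𝒲, τ, ρ, h⟩ => by
    refine ⟨𝒲.comap i, ⟨τ.idx, fun j => OrderHomClass.mono (Opens.comap i) (τ.le j)⟩,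
      ⟨ρ.idx, fun j => OrderHomClass.mono (Opens.comap i) (ρ.le j)⟩, ?_⟩
    obtain ⟨α, hα⟩ := comap_coh i h
    refine ⟨α, fun j k T a b => ?_⟩
    have := hα j k a b
    have hT : T ≤ (preim i).obj (𝒲.U j ⊓ 𝒲.U k) := le_inf (leOfHom a) (leOfHom b)
    have e1 := CechCocycle.map_ev i x.2 (j := τ.idx j) (k := τ.idx k)
      (A := x.1.U (τ.idx j) ⊓ x.1.U (τ.idx k))
      (hT.trans (OrderHomClass.mono (Opens.comap i) (inf_le_inf (τ.le j) (τ.le k)))) hT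
      (inf_le_inf (τ.le j) (τ.le k)) (homOfLE inf_le_left) (homOfLE inf_le_right)
    have e2 := CechCocycle.map_ev i y.2 (j := ρ.idx j) (k := ρ.idx k)
      (A := y.1.U (ρ.idx j) ⊓ y.1.U (ρ.idx k))
      (hT.trans (OrderHomClass.mono (Opens.comap i) (inf_le_inf (ρ.le j) (ρ.le k)))) hT
      (inf_le_inf (ρ.le j) (ρ.le k)) (homOfLE inf_le_left) (homOfLE inf_le_right)
    refine (congrArg (fun z => H.map a.op (α j) * z) e1).trans ?_
    refine Eq.trans ?_ (congrArg (fun z => z * H.map b.op (α k)) e2).symm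
    exact this

end CechH1
end Cech

/-! ### Subgroups of a presheaf of groups and their abelian quotients -/

section Quotients

variable {X : Type u} [TopologicalSpace X]

/-- A presheaf of subgroups of a presheaf of groups. -/
structure SubPresheaf (A : (Opens X)ᵒᵖ ⥤ GrpCat.{u}) where
  sub : ∀ U, Subgroup (A.obj U)
  map_mem : ∀ {U V : (Opens X)ᵒᵖ} (f : U ⟶ V) (a : A.obj U), a ∈ sub U → A.map f a ∈ sub V

namespace SubPresheaf

variable {A : (Opens X)ᵒᵖ ⥤ GrpCat.{u}}

/-- The underlying presheaf of groups. -/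
def toPresheaf (H : SubPresheaf A) : (Opens X)ᵒᵖ ⥤ GrpCat.{u} where
  obj U := GrpCat.of (H.sub U)
  map {U V} f := GrpCat.ofHom
    (((A.map f).hom.comp (H.sub U).subtype).codRestrict (H.sub V) fun a => H.map_mem f a a.2)
  map_id U := by
    ext a
    exact ConcreteCategory.congr_hom (A.map_id U) a.1
  map_comp f g := by
    ext a
    exact ConcreteCategory.congr_hom (A.map_comp f g) a.1

/-- The inclusion of a smaller presheaf of subgroups. -/
def incl {H' H : SubPresheaf A} (h : ∀ U, H'.sub U ≤ H.sub U) : H'.toPresheaf ⟶ H.toPresheaf where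
  app U := GrpCat.ofHom (Subgroup.inclusion (h U))
  naturality _ _ _ := rfl

/-- `N` contains all commutators of elements of `H`. -/
def CommIn (H N : SubPresheaf A) : Prop :=
  ∀ U, ∀ a ∈ H.sub U, ∀ b ∈ H.sub U, a * b * a⁻¹ * b⁻¹ ∈ N.sub U

theorem CommIn.normal {H N : SubPresheaf A} (hc : CommIn H N) (U : (Opens X)ᵒᵖ) :
    ((N.sub U).subgroupOf (H.sub U)).Normal := by
  refine ⟨fun n hn g => ?_⟩
  rw [Subgroup.mem_subgroupOf] at hn ⊢
  have := mul_mem (hc U g g.2 n n.2) hn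
  simpa [mul_assoc] using this

/-- The quotient group `H(U) / N(U)`. -/
abbrev Quo (H N : SubPresheaf A) (_ : CommIn H N) (U : (Opens X)ᵒᵖ) : Type u :=
  H.sub U ⧸ (N.sub U).subgroupOf (H.sub U)

instance (H N : SubPresheaf A) (hc : CommIn H N) (U : (Opens X)ᵒᵖ) : CommGroup (Quo H N hc U) :=
  letI := hc.normal U
  { (QuotientGroup.Quotient.group ((N.sub U).subgroupOf (H.sub U)) : Group (Quo H N hc U)) with
    mul_comm := by
      rintro ⟨a⟩ ⟨b⟩
      refine QuotientGroup.eq.2 ?_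
      rw [Subgroup.mem_subgroupOf]
      have := hc U _ (inv_mem b.2) _ (inv_mem a.2)
      simpa [mul_assoc] using this }

/-- The projection `H(U) → H(U) / N(U)`. -/
def mkHom (H N : SubPresheaf A) (hc : CommIn H N) (U : (Opens X)ᵒᵖ) :
    H.sub U →* Quo H N hc U where
  toFun a := QuotientGroup.mk a
  map_one' := rfl
  map_mul' _ _ := rfl

theorem mkHom_surjective (H N : SubPresheaf A) (hc : CommIn H N) (U : (Opens X)ᵒᵖ) :
    Function.Surjective (mkHom H N hc U) := QuotientGroup.mk_surjective

theorem mkHom_eq_one (H N : SubPresheaf A) (hc : CommIn H N) (U : (Opens X)ᵒᵖ) (a : H.sub U) :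
    mkHom H N hc U a = 1 ↔ a.1 ∈ N.sub U := by
  let _ := hc.normal U
  exact (QuotientGroup.eq_one_iff a).trans Subgroup.mem_subgroupOf

/-- Descent of a homomorphism to the quotient. -/
def descend {H N : SubPresheaf A} (hc : CommIn H N) (U : (Opens X)ᵒᵖ) {K : Type u} [Group K]
    (φ : H.sub U →* K) (hφ : ∀ a : H.sub U, a.1 ∈ N.sub U → φ a = 1) : Quo H N hc U →* K :=
  letI := hc.normal U
  { toFun := QuotientGroup.lift ((N.sub U).subgroupOf (H.sub U)) φ fun a ha =>
      hφ a (Subgroup.mem_subgroupOf.1 ha)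
    map_one' := map_one (QuotientGroup.lift ((N.sub U).subgroupOf (H.sub U)) φ _)
    map_mul' := map_mul (QuotientGroup.lift ((N.sub U).subgroupOf (H.sub U)) φ _) }

theorem quo_ext {H N : SubPresheaf A} {hc : CommIn H N} {U : (Opens X)ᵒᵖ} {K : Type u} [Group K]
    {φ ψ : Quo H N hc U →* K} (h : ∀ a, φ (mkHom H N hc U a) = ψ (mkHom H N hc U a)) : φ = ψ :=
  MonoidHom.ext fun z => by obtain ⟨a, rfl⟩ := mkHom_surjective H N hc U z; exact h a

/-- The map of quotients `H'(U) / N'(U) → H(V) / N(V)` induced by the inclusion and by the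
restriction from `U` to `V`. -/
def quoMap {H' N' H N : SubPresheaf A} (hc' : CommIn H' N') (hc : CommIn H N)
    (h : ∀ U, H'.sub U ≤ H.sub U) (hN : ∀ U, N'.sub U ≤ N.sub U) {U V : (Opens X)ᵒᵖ} (f : U ⟶ V) :
    Quo H' N' hc' U →* Quo H N hc V :=
  descend hc' U ((mkHom H N hc V).comp ((H.toPresheaf.map f).hom.comp (Subgroup.inclusion (h U))))
    fun _ ha => (mkHom_eq_one H N hc V _).2 (N.map_mem f _ (hN U ha))

theorem quoMap_id (H N : SubPresheaf A) (hc : CommIn H N) (U : (Opens X)ᵒᵖ) :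
    quoMap hc hc (fun _ => le_rfl) (fun _ => le_rfl) (𝟙 U) = MonoidHom.id (Quo H N hc U) :=
  quo_ext fun a => congrArg (mkHom H N hc U) (ConcreteCategory.congr_hom (H.toPresheaf.map_id U) a)

theorem quoMap_comp {H'' N'' H' N' H N : SubPresheaf A} (hc'' : CommIn H'' N'')
    (hc' : CommIn H' N') (hc : CommIn H N)
    (h' : ∀ U, H''.sub U ≤ H'.sub U) (hN' : ∀ U, N''.sub U ≤ N'.sub U)
    (h : ∀ U, H'.sub U ≤ H.sub U) (hN : ∀ U, N'.sub U ≤ N.sub U) {U V W : (Opens X)ᵒᵖ} (f : U ⟶ V)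
    (g : V ⟶ W) :
    (quoMap hc' hc h hN g).comp (quoMap hc'' hc' h' hN' f) =
      quoMap hc'' hc (fun U => (h' U).trans (h U)) (fun U => (hN' U).trans (hN U)) (f ≫ g) :=
  quo_ext fun a => congrArg (mkHom H N hc W) (Subtype.ext
    (ConcreteCategory.congr_hom (A.map_comp f g) a.1).symm)

/-- The presheaf of abelian groups `U ↦ H(U) / N(U)`. -/
def quoPresheaf (H N : SubPresheaf A) (hc : CommIn H N) : (Opens X)ᵒᵖ ⥤ AddCommGrpCat.{u} where
  obj U := AddCommGrpCat.of (Additive (Quo H N hc U))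
  map f := AddCommGrpCat.ofHom
    (MonoidHom.toAdditive (quoMap hc hc (fun _ => le_rfl) (fun _ => le_rfl) f))
  map_id U := by
    rw [quoMap_id]
    rfl
  map_comp {U V W} f g := by
    rw [← quoMap_comp hc hc hc (fun _ => le_rfl) (fun _ => le_rfl) (fun _ => le_rfl)
      (fun _ => le_rfl) f g]
    rfl

/-- The morphism of quotient presheaves induced by inclusions. -/
def quoPresheafMap {H' N' H N : SubPresheaf A} (hc' : CommIn H' N') (hc : CommIn H N)
    (h : ∀ U, H'.sub U ≤ H.sub U) (hN : ∀ U, N'.sub U ≤ N.sub U) :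
    quoPresheaf H' N' hc' ⟶ quoPresheaf H N hc where
  app U := AddCommGrpCat.ofHom (MonoidHom.toAdditive (quoMap hc' hc h hN (𝟙 U)))
  naturality U V f := by
    have e : (quoMap hc' hc h hN (𝟙 V)).comp
          (quoMap hc' hc' (fun _ => le_rfl) (fun _ => le_rfl) f) =
        (quoMap hc hc (fun _ => le_rfl) (fun _ => le_rfl) f).comp (quoMap hc' hc h hN (𝟙 U)) := by
      rw [quoMap_comp, quoMap_comp, Category.comp_id, Category.id_comp]
    exact congrArg (fun φ : Quo H' N' hc' U →* Quo H N hc V =>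
      AddCommGrpCat.ofHom (MonoidHom.toAdditive φ)) e

/-- A presheaf of abelian groups, regarded as a presheaf of (multiplicatively written) groups. -/
abbrev asGroups (P : (Opens X)ᵒᵖ ⥤ AddCommGrpCat.{u}) : (Opens X)ᵒᵖ ⥤ GrpCat.{u} :=
  P ⋙ AddCommGrpCat.toCommGrp ⋙ forget₂ CommGrpCat GrpCat

/-- The projection of `H` onto the quotient presheaf. -/
def proj (H N : SubPresheaf A) (hc : CommIn H N) :
    H.toPresheaf ⟶ asGroups (quoPresheaf H N hc) where
  app U := GrpCat.ofHom (Y := Multiplicative (Additive (Quo H N hc U))) (mkHom H N hc U)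
  naturality _ _ _ := rfl

/-- The quotient sheaf of abelian groups `H / N`, the sheafification of `U ↦ H(U) / N(U)`. -/
noncomputable def quoSheaf (H N : SubPresheaf A) (hc : CommIn H N) :
    Sheaf (Opens.grothendieckTopology X) AddCommGrpCat.{u} :=
  (presheafToSheaf (Opens.grothendieckTopology X) AddCommGrpCat.{u}).obj (quoPresheaf H N hc)

/-- The projection of `H` onto the quotient sheaf. -/
noncomputable def projSheaf (H N : SubPresheaf A) (hc : CommIn H N) :
    H.toPresheaf ⟶ asGroups (quoSheaf H N hc).obj :=
  proj H N hc ≫ Functor.whiskerRight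
    (toSheafify (Opens.grothendieckTopology X) (quoPresheaf H N hc)) _

/-- The morphism of quotient sheaves induced by inclusions. -/
noncomputable def quoSheafMap {H' N' H N : SubPresheaf A} (hc' : CommIn H' N') (hc : CommIn H N)
    (h : ∀ U, H'.sub U ≤ H.sub U) (hN : ∀ U, N'.sub U ≤ N.sub U) :
    quoSheaf H' N' hc' ⟶ quoSheaf H N hc :=
  (presheafToSheaf (Opens.grothendieckTopology X) AddCommGrpCat.{u}).map
    (quoPresheafMap hc' hc h hN)

end SubPresheaf

/-- The first cohomology `H¹(X, F)` of a sheaf of abelian groups, computed by Čech cocycles on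
arbitrary open covers (in degree one this agrees with sheaf cohomology on every space). -/
def AbH1 (F : Sheaf (Opens.grothendieckTopology X) AddCommGrpCat.{u}) : Type (u + 1) :=
  CechH1 (SubPresheaf.asGroups F.obj)

/-- The zero class in `H¹(X, F)`. -/
instance (F : Sheaf (Opens.grothendieckTopology X) AddCommGrpCat.{u}) : Zero (AbH1 F) :=
  ⟨CechH1.basepoint _⟩

/-- The map `H¹(X, F) → H¹(X, F')` induced by a morphism of sheaves of abelian groups. -/
def AbH1.map {F F' : Sheaf (Opens.grothendieckTopology X) AddCommGrpCat.{u}} (f : F ⟶ F') :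
    AbH1 F → AbH1 F' :=
  CechH1.map (Functor.whiskerRight f.hom (AddCommGrpCat.toCommGrp ⋙ forget₂ CommGrpCat GrpCat))

end Quotients

/-! ### Split supermanifolds, obstructions and embeddings -/

namespace Supergeometry

variable (S : Supergeometry.{u})

/-- Green's sheaf of groups `𝒢⁽ᵏ⁾`, a subsheaf of groups of the sheaf of automorphisms of
`⋀^• E`. -/
def green (k : ℕ) : SubPresheaf S.autPresheaf where
  sub U := S.greenSub k U.unop
  map_mem f _ hα V hV s := hα V (hV.trans (leOfHom f.unop)) s

theorem green_commIn {k : ℕ} (hk : 2 ≤ k) : (S.green k).CommIn (S.green (k + 1)) :=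
  fun _ _ ha _ hb => green_comm hk ha hb

/-- The set `Ȟ¹(X, 𝒢⁽ᵏ⁾)` of `(k-1)`-split supermanifolds modelled on the supergeometry `S`. -/
abbrev SplitSupermanifold (k : ℕ) : Type (u + 1) := CechH1 (S.green k).toPresheaf

/-- The `k`-th obstruction sheaf `𝒬⁽ᵏ⁾ = 𝒢⁽ᵏ⁾ / 𝒢⁽ᵏ⁺¹⁾`. -/
noncomputable def obstructionSheaf (k : ℕ) (hk : 2 ≤ k) :
    Sheaf (Opens.grothendieckTopology S.X) AddCommGrpCat.{u} :=
  (S.green k).quoSheaf (S.green (k + 1)) (S.green_commIn hk)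

/-- The primary obstruction of a `(k-1)`-split supermanifold, the map
`Ȟ¹(X, 𝒢⁽ᵏ⁾) → H¹(X, 𝒬⁽ᵏ⁾)` induced by the projection `𝒢⁽ᵏ⁾ → 𝒬⁽ᵏ⁾`. -/
noncomputable def primaryObstruction (k : ℕ) (hk : 2 ≤ k) :
    S.SplitSupermanifold k → AbH1 (S.obstructionSheaf k hk) :=
  CechH1.map ((S.green k).projSheaf (S.green (k + 1)) (S.green_commIn hk))

end Supergeometry

namespace SuperEmbedding

open Supergeometry

variable {Y S : Supergeometry.{u}} (f : SuperEmbedding Y S)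

/-- The sheaf of groups `𝒢⁽ᵏ⁾_{Y;S}` on `S.X` of those elements of `𝒢⁽ᵏ⁾_S` which preserve the kernel
of `⋀^• E_S → i_* ⋀^• E_Y`. -/
def green (k : ℕ) : SubPresheaf S.autPresheaf where
  sub U := S.greenSub k U.unop ⊓ f.presSub U.unop
  map_mem g _ hα := ⟨(S.green k).map_mem g _ hα.1,
    fun V hV s => hα.2 V (hV.trans (leOfHom g.unop)) s⟩

theorem green_le (k : ℕ) (U : (Opens S.X)ᵒᵖ) : (f.green k).sub U ≤ (S.green k).sub U := inf_le_left

theorem green_commIn {k : ℕ} (hk : 2 ≤ k) : (f.green k).CommIn (f.green (k + 1)) :=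
  fun U _ ha _ hb => ⟨green_comm hk ha.1 hb.1,
    let P := f.presSub U.unop
    P.mul_mem (P.mul_mem (P.mul_mem ha.2 hb.2) (P.inv_mem ha.2)) (P.inv_mem hb.2)⟩

/-- The inclusion `u : 𝒢⁽ᵏ⁾_{Y;S} → 𝒢⁽ᵏ⁾_S`. -/
def u (k : ℕ) : (f.green k).toPresheaf ⟶ (S.green k).toPresheaf := SubPresheaf.incl (f.green_le k)

/-- The restriction `r : 𝒢⁽ᵏ⁾_{Y;S} → i_* 𝒢⁽ᵏ⁾_Y` of automorphisms to the submanifold. -/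
noncomputable def r (k : ℕ) :
    (f.green k).toPresheaf ⟶ (CechH1.preim f.cmap).op ⋙ (Y.green k).toPresheaf where
  app U := GrpCat.ofHom
    (X := (f.green k).sub U) (Y := (Y.green k).sub (op (f.pre U.unop)))
    (((restrictHom f U.unop).comp (Subgroup.inclusion inf_le_right)).codRestrict
      (Y.greenSub k (f.pre U.unop)) fun α => restrictHom_green α.2.1)
  naturality U V g := by
    ext α
    refine Subtype.ext (α := SuperAut Y (f.pre V.unop)) (p := fun γ => γ ∈ Y.greenSub k _) ?_
    exact restrictHom_restr (leOfHom g.unop) ⟨α.1, α.2.2⟩ ((f.green k).map_mem g _ α.2).2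

/-- The `k`-th obstruction sheaf `𝒬⁽ᵏ⁾_{Y;S} = 𝒢⁽ᵏ⁾_{Y;S} / 𝒢⁽ᵏ⁺¹⁾_{Y;S}` of the embedding. -/
noncomputable def obstructionSheaf (k : ℕ) (hk : 2 ≤ k) :
    Sheaf (Opens.grothendieckTopology S.X) AddCommGrpCat.{u} :=
  (f.green k).quoSheaf (f.green (k + 1)) (f.green_commIn hk)

/-- The inclusion `ι : 𝒬⁽ᵏ⁾_{Y;S} → 𝒬⁽ᵏ⁾_S`. -/
noncomputable def ι (k : ℕ) (hk : 2 ≤ k) : f.obstructionSheaf k hk ⟶ S.obstructionSheaf k hk :=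
  SubPresheaf.quoSheafMap (f.green_commIn hk) (S.green_commIn hk) (f.green_le k)
    (f.green_le (k + 1))

/-- The quotient sheaf `ℛ⁽ᵏ⁾ = 𝒬⁽ᵏ⁾_S / 𝒬⁽ᵏ⁾_{Y;S}`. -/
noncomputable def quotientSheaf (k : ℕ) (hk : 2 ≤ k) :
    Sheaf (Opens.grothendieckTopology S.X) AddCommGrpCat.{u} :=
  Limits.cokernel (f.ι k hk)

/-- The map `β : H¹(X, 𝒬⁽ᵏ⁾_S) → H¹(X, ℛ⁽ᵏ⁾)` induced by the projection `𝒬⁽ᵏ⁾_S → ℛ⁽ᵏ⁾`. -/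
noncomputable def β (k : ℕ) (hk : 2 ≤ k) :
    AbH1 (S.obstructionSheaf k hk) → AbH1 (f.quotientSheaf k hk) :=
  AbH1.map (Limits.cokernel.π (f.ι k hk))

/-- `𝔜` is a submanifold of `𝔛`, embedded over `f`: there is a `(k-1)`-split embedding, i.e. a class
`𝒵 ∈ Ȟ¹(X, 𝒢⁽ᵏ⁾_{Y;S})`, with `r_* 𝒵 = 𝔜` and `u_* 𝒵 = 𝔛`. -/
def EmbeddedOver (k : ℕ) (𝔜 : Y.SplitSupermanifold k) (𝔛 : S.SplitSupermanifold k) : Prop :=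
  ∃ 𝒵 : CechH1 (f.green k).toPresheaf,
    CechH1.comap f.cmap (Y.green k).toPresheaf (CechH1.map (f.r k) 𝒵) = 𝔜 ∧
      CechH1.map (f.u k) 𝒵 = 𝔛

end SuperEmbedding

/-!
If `𝔜` were a submanifold of `𝔛` over `f`, then `𝔛 = u_* 𝒵` for a class `𝒵` with values in
`𝒢⁽ᵏ⁾_{Y;X}`.  The composite `𝒢⁽ᵏ⁾_{Y;X} → 𝒢⁽ᵏ⁾_X → 𝒬⁽ᵏ⁾_X` factors through `𝒬⁽ᵏ⁾_{Y;X}`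
(`SubPresheaf.incl_projSheaf`), so following it by the projection onto the cokernel `ℛ⁽ᵏ⁾` of
`ι : 𝒬⁽ᵏ⁾_{Y;X} → 𝒬⁽ᵏ⁾_X` gives the trivial morphism.  A morphism which is trivial on sections
induces the trivial map on `Ȟ¹` (`CechH1.map_eq_basepoint`), hence `β(ω(𝔛)) = 0`.
-/

section

variable {X : Type u} [TopologicalSpace X]

namespace CechH1

variable {G G' G'' : (Opens X)ᵒᵖ ⥤ GrpCat.{u}}

theorem map_map (f : G ⟶ G') (g : G' ⟶ G'') (x : CechH1 G) : map g (map f x) = map (f ≫ g) x := by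
  induction x using Quotient.inductionOn
  rfl

theorem map_eq_basepoint (f : G ⟶ G') (hf : ∀ (U : (Opens X)ᵒᵖ) (a : G.obj U), f.app U a = 1)
    (x : CechH1 G) : map f x = basepoint G' := by
  induction x using Quotient.inductionOn with
  | h x =>
    refine Quotient.sound ⟨x.1, ⟨id, fun _ => le_rfl⟩, ⟨fun _ => ⟨⟩, fun _ => le_top⟩, 1, ?_⟩
    intro i j T a b
    have h1 : (CechCocycle.refine ⟨id, fun _ => le_rfl⟩ (CechCocycle.map f x.2) :
        CechCocycle G' x.1).ev i j a b = 1 := hf _ _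
    change G'.map a.op 1 * _ = 1 * G'.map b.op 1
    rw [map_one, map_one, one_mul, one_mul]
    exact h1

end CechH1

namespace SubPresheaf

variable {A : (Opens X)ᵒᵖ ⥤ GrpCat.{u}}

/-- The composite `H' → H → H / N` factors through the morphism `H' / N' → H / N` of quotient
sheaves: this is clear for the quotient presheaves, and sheafification is natural. -/
theorem incl_projSheaf {H' N' H N : SubPresheaf A} (hc' : CommIn H' N') (hc : CommIn H N)
    (h : ∀ U, H'.sub U ≤ H.sub U) (hN : ∀ U, N'.sub U ≤ N.sub U) :
    incl h ≫ projSheaf H N hc = projSheaf H' N' hc' ≫ Functor.whiskerRight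
      (quoSheafMap hc' hc h hN).hom (AddCommGrpCat.toCommGrp ⋙ forget₂ CommGrpCat GrpCat) := by
  have e : incl h ≫ proj H N hc = proj H' N' hc' ≫ Functor.whiskerRight
      (quoPresheafMap hc' hc h hN) (AddCommGrpCat.toCommGrp ⋙ forget₂ CommGrpCat GrpCat) := by
    ext U a
    exact congrArg (mkHom H N hc U) (ConcreteCategory.congr_hom (H.toPresheaf.map_id U) _).symm
  have n := toSheafify_naturality (Opens.grothendieckTopology X) (quoPresheafMap hc' hc h hN)
  let F := AddCommGrpCat.toCommGrp.{u} ⋙ forget₂ CommGrpCat GrpCat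
  have n' : Functor.whiskerRight (quoPresheafMap hc' hc h hN) F ≫
        Functor.whiskerRight (toSheafify (Opens.grothendieckTopology X) (quoPresheaf H N hc)) F =
      Functor.whiskerRight (toSheafify (Opens.grothendieckTopology X) (quoPresheaf H' N' hc')) F ≫
        Functor.whiskerRight (quoSheafMap hc' hc h hN).hom F :=
    congrArg (fun t => Functor.whiskerRight t F) n
  exact (Category.assoc _ _ _).symm.trans <| (congrArg (fun t => t ≫
      Functor.whiskerRight (toSheafify (Opens.grothendieckTopology X) (quoPresheaf H N hc)) F) e).trans <|
    (Category.assoc _ _ _).trans <| (congrArg (proj H' N' hc' ≫ ·) n').trans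
      (Category.assoc _ _ _).symm

end SubPresheaf

end

/-- The obstruction `β(ω(𝔛))` vanishes if `𝔛` comes from a class with values in `𝒢⁽ᵏ⁾_{Y;X}`. -/
theorem SuperEmbedding.β_primaryObstruction_map_u {Y X : Supergeometry.{u}}
    (f : SuperEmbedding Y X) (k : ℕ) (hk : 2 ≤ k) (𝒵 : CechH1 (f.green k).toPresheaf) :
    f.β k hk (X.primaryObstruction k hk (CechH1.map (f.u k) 𝒵)) = 0 := by
  unfold SuperEmbedding.β AbH1.map Supergeometry.primaryObstruction
  erw [CechH1.map_map, CechH1.map_map]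
  refine CechH1.map_eq_basepoint _ (fun U a => ?_) 𝒵
  have e := SubPresheaf.incl_projSheaf (f.green_commIn hk) (X.green_commIn hk) (f.green_le k)
    (f.green_le (k + 1))
  have c : (f.ι k hk).hom ≫ (Limits.cokernel.π (f.ι k hk)).hom = 0 :=
    congrArg (fun t => t.hom) (Limits.cokernel.condition (f.ι k hk))
  have e' := ConcreteCategory.congr_hom (NatTrans.congr_app e U) a
  -- `asGroups` only relabels an additive group as a multiplicative one, so the value of the
  -- composite at `a` is that of `cokernel.π` at the image of `a` in `𝒬⁽ᵏ⁾_X`, which comes from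
  -- `𝒬⁽ᵏ⁾_{Y;X}`.
  refine (congrArg (fun t => Multiplicative.ofAdd
    ((Limits.cokernel.π (f.ι k hk)).hom.app U (Multiplicative.toAdd t))) e').trans ?_
  let b : (f.obstructionSheaf k hk).obj.obj U :=
    ((f.green k).projSheaf (f.green (k + 1)) (f.green_commIn hk)).app U a
  exact congrArg Multiplicative.ofAdd (ConcreteCategory.congr_hom (NatTrans.congr_app c U) b)

theorem mainTheorem10 {Y X : Supergeometry.{u}} (f : SuperEmbedding Y X) (k : ℕ) (hk : 2 ≤ k)
    (𝔛 : X.SplitSupermanifold k) (h : f.β k hk (X.primaryObstruction k hk 𝔛) ≠ 0) :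
    ¬ ∃ 𝔜 : Y.SplitSupermanifold k, f.EmbeddedOver k 𝔜 𝔛 := by
  rintro ⟨_, 𝒵, _, rfl⟩
  exact h (f.β_primaryObstruction_map_u k hk 𝒵)
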